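/- Let $n\ge 1$. Given $\alpha_0,\dots,\alpha_{n-2}$ in the open unit disk and $\alpha_{n-1}$ on the unit circle, put $\rho_j=\sqrt{1-|\alpha_j|^2}$, $\Xi_j=\begin{bmatrix}\bar\alpha_j&\rho_j\\ \rho_j&-\alpha_j\end{bmatrix}$ for $0\le j\le n-2$, and let $\Xi_{-1}=[1]$, $\Xi_{n-1}=[\bar\alpha_{n-1}]$ be $1\times1$ matrices. The CMV matrix with Verblunsky coefficients $\alpha_0,\dots,\alpha_{n-1}$ is the $n\times n$ matrix $\mathcal C=\mathcal L\mathcal M$, where $\mathcal L=\operatorname{diag}(\Xi_0,\Xi_2,\dots)$ and $\mathcal M=\operatorname{diag}(\Xi_{-1},\Xi_1,\Xi_3,\dots)$. On the real vector space of complex $n\times n$ matrices, let $\langle X,Y\rangle=\operatorname{Im}\operatorname{tr}(XY)$, let $\nabla\phi$ be the gradient with respect to this pairing, let $R(L+A)=L-A$ for $L$ lower triangular with real diagonal and $A$ anti-Hermitian, and let the Poisson bracket be $$\{\phi,\psi\}(B)=\tfrac12\langle R(XB),YB\rangle-\tfrac12\langle R(BX),BY\rangle,\qquad X=\nabla\phi|_B,\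 Y=\nabla\psi|_B .$$ Let $f$ be a complex polynomial and $F(z)=2\operatorname{Re}[zf'(z)]$. Let $\mathcal C(t)$, $t\ge0$, be a trajectory of the flow generated by $\phi(B)=\operatorname{Im}\operatorname{tr}f(B)$ (that is, $\frac{d}{dt}\psi(\mathcal C(t))=\{\phi,\psi\}(\mathcal C(t))$ for all smooth real functions $\psi$) such that $\mathcal C(0)$ is a CMV matrix. Let $z_1,\dots,z_n$ be the eigenvalues of $\mathcal C(0)$, labelled so that $\lambda_j:=F(z_j)$ satisfies $\lambda_1\ge\lambda_2\ge\dots\ge\lambda_n$, and let $\mu_j$ be the mass that the spectral measure of $\mathcal C(0)$ and the vector $e_1=[1,0,\dots,0]^T$ gives to $z_j$. For a finite set $I$ of indices write $\mu_I=\prod_{i\in I}\mu_i$, $z_I=\prod_{i\in I}z_i$ and $\Delta_I=\prod_{i<j,\ i,j\in I}(z_j-z_i)$. Then $\mathcal C(t)$ is a CMV matrix for every $t\ge0$, and its Verblunsky coefficients $\alpha_0(t),\dots,\alpha_{n-1}(t)$ have the following properties for each $1\le k\le n-1$. Let $B_k=\{l:\lambda_l=\lambda_k\}$, $J=\{l:\lambda_l>\lambda_k\}$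 and $s(k)=|J|$, so that $J=\{1,\dots,s(k)\}$. (1) As $t\to\infty$, $$\alpha_{k-1}(t)\to(-1)^{k-1}\,\bar z_J\,\frac{\sum_I|\Delta_{J\cup I}|^2\mu_I\bar z_I}{\sum_I|\Delta_{J\cup I}|^2\mu_I},$$ where both sums run over all $I\subseteq B_k$ with $k-s(k)$ elements. (2) $|\alpha_{k-1}(t)|\to1$ if and only if $\lambda_k>\lambda_{k+1}$. (3) If all $\lambda_j$ are distinct, then $\lambda_k-\lambda_{k+1}>0$ and there is $\gamma>\lambda_k-\lambda_{k+1}$ such that, as $t\to\infty$, $$\alpha_{k-1}(t)=(-1)^{k-1}\bar z_1\cdots\bar z_k\Bigl[1+\xi_{k-1}e^{-(\lambda_k-\lambda_{k+1})t}+O(e^{-\gamma t})\Bigr],\qquad \xi_{k-1}=(z_k\bar z_{k+1}-1)\frac{\mu_{k+1}}{\mu_k}\prod_{l=1}^{k-1}\left|\frac{z_{k+1}-z_l}{z_k-z_l}\right|^2 .$$ -/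

import Mathlib

open Filter Topology Asymptotics
open scoped ContDiff Matrix ComplexConjugate

noncomputable section

namespace CMVFlow

/-! ### CMV matrices -/

/-- Admissible Verblunsky coefficients `α_0, …, α_{n-1}`: all of them in the open unit disk,
except for the last one, which lies on the unit circle. -/
def IsVerblunsky {n : ℕ} (α : Fin n → ℂ) : Prop :=
  ∀ j : Fin n, if j.val + 1 < n then ‖α j‖ < 1 else ‖α j‖ = 1

/-- `ρ = √(1 - |α|²)`. -/
def rho (a : ℂ) : ℝ := Real.sqrt (1 - ‖a‖ ^ 2)

/-- The `n × n` block-diagonal matrix (indices start at `0`) that is built from the blocks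
`Ξ_m = [[conj α_m, ρ_m], [ρ_m, -α_m]]` in the rows and columns `m, m + 1`, for all `m` of the
same parity as `p`; for `m = n - 1` only the corner `[conj α_{n-1}]` of the block is there, and
if row `0` is not covered (that is, `p` is odd), it carries the block `Ξ_{-1} = [1]`. -/
def blockFactor (p : ℕ) {n : ℕ} (α : Fin n → ℂ) : Matrix (Fin n) (Fin n) ℂ :=
  Matrix.of fun i j =>
    if i = j then
      if i.val % 2 = p % 2 then conj (α i)
      else if i.val = 0 then 1
      else -α ⟨i.val - 1, by omega⟩
    else if i.val + 1 = j.val ∧ i.val % 2 = p % 2 then (rho (α i) : ℂ)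
    else if j.val + 1 = i.val ∧ j.val % 2 = p % 2 then (rho (α j) : ℂ)
    else 0

/-- The CMV matrix `C = L M` with `L = diag(Ξ_0, Ξ_2, Ξ_4, …)` and
`M = diag(Ξ_{-1}, Ξ_1, Ξ_3, …)`. -/
def cmv {n : ℕ} (α : Fin n → ℂ) : Matrix (Fin n) (Fin n) ℂ :=
  blockFactor 0 α * blockFactor 1 α

/-! ### The quadratic (Gelfand-Dikij) Poisson bracket on complex matrices -/

/-- The pairing `⟨X, Y⟩ = Im tr (X Y)`. -/
def pairing {n : ℕ} (X Y : Matrix (Fin n) (Fin n) ℂ) : ℝ := (X * Y).trace.im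

/-- The projection onto the anti-Hermitian matrices, along the lower triangular matrices with
real diagonal. -/
def projA {n : ℕ} (X : Matrix (Fin n) (Fin n) ℂ) : Matrix (Fin n) (Fin n) ℂ :=
  Matrix.of fun i j =>
    if i < j then X i j
    else if j < i then -conj (X j i)
    else Complex.I * ((X i i).im : ℂ)

/-- The projection onto the lower triangular matrices with real diagonal, along the
anti-Hermitian matrices. -/
def projL {n : ℕ} (X : Matrix (Fin n) (Fin n) ℂ) : Matrix (Fin n) (Fin n) ℂ := X - projA X

theorem projA_conjTranspose {n : ℕ} (X : Matrix (Fin n) (Fin n) ℂ) :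
    (projA X)ᴴ = -projA X := by
  ext i j
  rcases lt_trichotomy i j with h | h | h
  · simp [projA, h, h.not_gt]
  · subst h
    simp [projA]
  · simp [projA, h, h.not_gt]

theorem projL_upper {n : ℕ} (X : Matrix (Fin n) (Fin n) ℂ) {i j : Fin n} (h : i < j) :
    projL X i j = 0 := by
  simp [projL, projA, h]

theorem projL_diag {n : ℕ} (X : Matrix (Fin n) (Fin n) ℂ) (i : Fin n) :
    (projL X i i).im = 0 := by
  simp [projL, projA]

/-- `R(L + A) = L - A` for `L` lower triangular with real diagonal and `A` anti-Hermitian. -/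
def rMatrix {n : ℕ} (X : Matrix (Fin n) (Fin n) ℂ) : Matrix (Fin n) (Fin n) ℂ :=
  projL X - projA X

/-- The gradient `∇φ` at `B`, with respect to the pairing: the `(k, l)` entry is
`∂φ/∂v_{l,k} + i ∂φ/∂u_{l,k}`, where the matrix entries are `b_{k,l} = u_{k,l} + i v_{k,l}`. -/
def grad {n : ℕ} (φ : Matrix (Fin n) (Fin n) ℂ → ℝ) (B : Matrix (Fin n) (Fin n) ℂ) :
    Matrix (Fin n) (Fin n) ℂ :=
  Matrix.of fun k l =>
    ((lineDeriv ℝ φ B (Matrix.single l k Complex.I) : ℝ) : ℂ)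
      + Complex.I * ((lineDeriv ℝ φ B (Matrix.single l k 1) : ℝ) : ℂ)

/-- The Poisson bracket `{φ, ψ}` at `B`: with `X = ∇φ` and `Y = ∇ψ`, it is
`½ ⟨R(X B), Y B⟩ - ½ ⟨R(B X), B Y⟩`. -/
def bracket {n : ℕ} (φ ψ : Matrix (Fin n) (Fin n) ℂ → ℝ) (B : Matrix (Fin n) (Fin n) ℂ) : ℝ :=
  (1 / 2) * pairing (rMatrix (grad φ B * B)) (grad ψ B * B)
    - (1 / 2) * pairing (rMatrix (B * grad φ B)) (B * grad ψ B)

section Flow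

attribute [local instance] Matrix.normedAddCommGroup Matrix.normedSpace

/-- `C(t)`, `t ≥ 0`, moves under the flow generated by the Hamiltonian `φ`: along `C`, every
smooth function `ψ` satisfies `dψ/dt = {φ, ψ}`. -/
def IsTrajectory {n : ℕ} (φ : Matrix (Fin n) (Fin n) ℂ → ℝ)
    (C : ℝ → Matrix (Fin n) (Fin n) ℂ) : Prop :=
  ∀ ψ : Matrix (Fin n) (Fin n) ℂ → ℝ, ContDiff ℝ ∞ ψ → ∀ t : ℝ, 0 ≤ t →
    HasDerivWithinAt (fun s => ψ (C s)) (bracket φ ψ (C t)) (Set.Ici 0) t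

end Flow

/-- The Hamiltonian `φ(B) = Im tr f(B)` of a polynomial `f`. -/
def hamiltonian {n : ℕ} (f : Polynomial ℂ) (B : Matrix (Fin n) (Fin n) ℂ) : ℝ :=
  (Polynomial.aeval B f).trace.im

/-- `F(z) = 2 Re (z f'(z))`. -/
def rate (f : Polynomial ℂ) (z : ℂ) : ℝ := 2 * (z * f.derivative.eval z).re

/-! ### Spectral data and the asymptotic quantities -/

/-- The mass that the spectral measure of the (normal) matrix `C` and the vector `e_1` gives to
the point `w`: the squared norm of the orthogonal projection of `e_1` onto the eigenspace
`ker (C - w)`. -/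
def spectralMass {n : ℕ} [NeZero n] (C : Matrix (Fin n) (Fin n) ℂ) (w : ℂ) : ℝ :=
  ‖(Module.End.eigenspace (Matrix.toEuclideanLin C) w).starProjection
    (EuclideanSpace.single (0 : Fin n) (1 : ℂ))‖ ^ 2

/-- `μ_I`, `z_I`: products over a multi-index. -/
def multi {n : ℕ} {M : Type} [CommMonoid M] (x : Fin n → M) (I : Finset (Fin n)) : M :=
  ∏ i ∈ I, x i

/-- The Vandermonde determinant `Δ_I` of the points `z_i`, `i ∈ I`, in increasing order. -/
def vander {n : ℕ} (z : Fin n → ℂ) (I : Finset (Fin n)) : ℂ :=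
  ∏ p ∈ (I ×ˢ I).filter (fun p => p.1 < p.2), (z p.2 - z p.1)

/-- `B_a`: the indices whose `λ` is tied with `λ_a`. -/
def tied {n : ℕ} (lam : Fin n → ℝ) (a : Fin n) : Finset (Fin n) :=
  Finset.univ.filter fun l => lam l = lam a

/-- `J`: the indices with a strictly larger `λ` than `λ_a`. If `λ` is non-increasing, these are
the indices before `B_a`. -/
def above {n : ℕ} (lam : Fin n → ℝ) (a : Fin n) : Finset (Fin n) :=
  Finset.univ.filter fun l => lam a < lam l

/-- The sets `I ⊆ B_a` with `k - s` elements, where `k = a + 1` (the indices start at `0`) and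
`s` is the number of elements of `J`. -/
def choices {n : ℕ} (lam : Fin n → ℝ) (a : Fin n) : Finset (Finset (Fin n)) :=
  (tied lam a).powersetCard (a.val + 1 - (above lam a).card)

/-- `(-1)^{k-1} conj z_J (∑ |Δ_{J ∪ I}|² μ_I conj z_I) / (∑ |Δ_{J ∪ I}|² μ_I)`, where
`k - 1 = a` and the sums run over all `I ⊆ B_a` with `|J| + |I| = k`. -/
def limitValue {n : ℕ} (lam : Fin n → ℝ) (z : Fin n → ℂ) (μ : Fin n → ℝ) (a : Fin n) : ℂ :=
  (-1) ^ a.val * conj (multi z (above lam a)) *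
    ((∑ I ∈ choices lam a,
        ((‖vander z (above lam a ∪ I)‖ ^ 2 * multi μ I : ℝ) : ℂ) * conj (multi z I)) /
      ((∑ I ∈ choices lam a, ‖vander z (above lam a ∪ I)‖ ^ 2 * multi μ I : ℝ) : ℂ))

/-- `ξ = (z_a conj z_b - 1) (μ_b / μ_a) ∏_{l < a} |(z_b - z_l) / (z_a - z_l)|²`, used for
consecutive indices `a` and `b`. -/
def xi {n : ℕ} (z : Fin n → ℂ) (μ : Fin n → ℝ) (a b : Fin n) : ℂ :=
  (z a * conj (z b) - 1) * ((μ b / μ a : ℝ) : ℂ) *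
    ((∏ l ∈ Finset.Iio a, ‖(z b - z l) / (z a - z l)‖ ^ 2 : ℝ) : ℂ)

end CMVFlow

end

open CMVFlow

noncomputable section

namespace CMVFlow

/-! The flow is linearized by a triangular factorization. Testing the bracket on the entries gives
the Lax equation `C' = [C, L]`, where `L` is the lower triangular part of `g(C)` and `g(z) = z
f'(z)`. If `W' = -L W` and `W(0) = 1`, then `C(t) W = W C(0)`. With `C(0) = Q diag(z) Qᴴ`, the
matrix `X = W Q exp(t g(z))` satisfies `X' = A X` with `A` anti-Hermitian, so it stays unitary and
diagonalizes `C(t)` (`exists_lower_intertwining`). Conjugation by `W` keeps the staircase of zeros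
and positive corners of a CMV matrix, and a unitary matrix with that staircase is CMV
(`exists_eq_cmv`). Hence the flow stays among CMV matrices.

The coefficient `α_{k-1}` is read off from the leading `k × k` minor, which is `(-1)^{k-1} conj
α_{k-1}`. By Cauchy-Binet this minor of `X diag(z) Xᴴ` is the sum over `|I| = k` of `z_I` times the
squared modulus of the minor of `X` in the first `k` rows and the columns `I`. Lower triangular
factors change these minors only by a factor independent of `I`. One such factor turns the rows of
`Q` into `1, z̄, z, z̄², …` times the first row, so the squared minors of `Q` are proportional to
`μ_I |Δ_I|²` (`exists_norm_minor_eq`). The same formula for the identity matrix fixes the common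
constant, and so (`coefficient_eq`) `α_{k-1}(t)` is `(-1)^{k-1}` times the average of `conj z_I`
with the weights `μ_I |Δ_I|² exp(t ∑_{i ∈ I} λ_i)`.

The rest is the asymptotics of exponential averages. The maximal exponents belong to `I = J ∪ I'`
with `I' ⊆ B_k`, which gives the limit. Its modulus is `1` exactly when only one such `I` exists, by
strict convexity. For distinct `λ_j` the runner-up replaces `k` by `k + 1`, and it gives the first
correction. -/

/-! ### The Cauchy-Binet formula -/

/-- The Cauchy-Binet formula: the minors are indexed by increasing maps. -/
theorem det_mul_eq_sum_orderEmbedding {k n : ℕ} (A : Matrix (Fin k) (Fin n) ℂ)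
    (B : Matrix (Fin n) (Fin k) ℂ) :
    (A * B).det = ∑ e : Fin k ↪o Fin n, (A.submatrix id e).det * (B.submatrix e id).det := by
  have h1 : (A * B).det
      = ∑ f : Fin k → Fin n, (A.submatrix id f).det * ∏ i, B (f i) i := by
    simp only [Matrix.det_apply', Matrix.mul_apply, Finset.prod_univ_sum, Finset.mul_sum,
      Fintype.piFinset_univ, Matrix.submatrix_apply, id, Finset.sum_mul]
    rw [Finset.sum_comm]
    refine Finset.sum_congr rfl fun f _ => Finset.sum_congr rfl fun σ _ => ?_
    rw [Finset.prod_mul_distrib]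
    ring
  -- An injective map is an increasing map composed with a permutation, in a unique way; a map that
  -- is not injective repeats a column of `A` and contributes zero.
  let F : (Fin k ↪o Fin n) × Equiv.Perm (Fin k) → (Fin k → Fin n) := fun p => p.1 ∘ p.2
  have hF : Function.Injective F := by
    rintro ⟨e, σ⟩ ⟨e', σ'⟩ h
    have hr : Set.range e = Set.range e' := by
      have := congrArg Set.range h
      simpa [F, Set.range_comp] using this
    have he : e = e' := by
      apply (Set.powersetCard.ofFinEmbEquiv (n := k) (I := Fin n)).injective
      refine SetLike.ext fun x => ?_
      rw [Set.powersetCard.mem_ofFinEmbEquiv_iff_mem_range,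
        Set.powersetCard.mem_ofFinEmbEquiv_iff_mem_range, hr]
    subst he
    congr 1
    ext i
    have := congrFun h i
    simpa [F] using congrArg Fin.val (e.injective this)
  have hzero : ∀ f ∉ Set.range F, (A.submatrix id f).det * ∏ i, B (f i) i = 0 := by
    intro f hf
    have hni : ¬ Function.Injective f := by
      intro hi
      apply hf
      let s : Set.powersetCard (Fin n) k := Set.powersetCard.ofFinEmb k (Fin n) ⟨f, hi⟩
      let e := Set.powersetCard.ofFinEmbEquiv.symm s
      have hes : ∀ x, x ∈ Set.range f ↔ x ∈ Set.range e := by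
        intro x
        rw [← Set.powersetCard.mem_ofFinEmbEquiv_iff_mem_range, Equiv.apply_symm_apply]
        exact (Set.powersetCard.mem_ofFinEmb_iff_mem_range k (Fin n) ⟨f, hi⟩ x).symm
      choose τ hτ using fun i => (hes (f i)).1 ⟨i, rfl⟩
      have hτi : Function.Injective τ := fun i j hij => hi (by rw [← hτ i, ← hτ j, hij])
      exact ⟨(e, Equiv.ofBijective τ (Finite.injective_iff_bijective.1 hτi)), funext hτ⟩
    obtain ⟨i, j, hij, hne⟩ : ∃ i j, f i = f j ∧ i ≠ j := by
      simpa [Function.Injective] using hni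
    rw [Matrix.det_zero_of_column_eq hne (by intro l; simp [hij]), zero_mul]
  rw [h1, ← Fintype.sum_of_injective F hF
    (fun p => (A.submatrix id (F p)).det * ∏ i, B (F p i) i) _ hzero (fun _ => rfl),
    Fintype.sum_prod_type]
  refine Finset.sum_congr rfl fun e _ => ?_
  have h2 : ∀ σ : Equiv.Perm (Fin k), (A.submatrix id (F (e, σ))).det
      = (Equiv.Perm.sign σ : ℂ) * (A.submatrix id e).det := by
    intro σ
    rw [← Matrix.det_permute' σ]
    rfl
  simp only [h2]
  rw [Matrix.det_apply' (B.submatrix e id), Finset.mul_sum]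
  rw [← Equiv.sum_comp (Equiv.inv (Equiv.Perm (Fin k)))]
  rw [← Equiv.sum_comp (Equiv.inv (Equiv.Perm (Fin k)))]
  refine Finset.sum_congr rfl fun σ _ => ?_
  simp [F]
  ring

/-! ### Unitary diagonalization -/

/-- Two families with the same associated polynomial differ by a permutation. -/
theorem exists_perm_of_prod_X_sub_C_eq {n : ℕ} {d z : Fin n → ℂ}
    (h : ∏ j, (Polynomial.X - Polynomial.C (d j)) = ∏ j, (Polynomial.X - Polynomial.C (z j))) :
    ∃ σ : Equiv.Perm (Fin n), ∀ i, d (σ i) = z i := by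
  have hm : Multiset.map d Finset.univ.val = Multiset.map z Finset.univ.val := by
    have hr : ∀ y : Fin n → ℂ, (∏ j, (Polynomial.X - Polynomial.C (y j))).roots
        = Multiset.map y Finset.univ.val := by
      intro y
      rw [← Polynomial.roots_multiset_prod_X_sub_C (Multiset.map y Finset.univ.val),
        Multiset.map_map]
      rfl
    rw [← hr, ← hr, h]
  have hc : ∀ w, Fintype.card {i // z i = w} = Fintype.card {i // d i = w} := by
    intro w
    have := congrArg (Multiset.count w) hm
    rw [Multiset.count_map, Multiset.count_map] at this
    rw [Fintype.card_subtype, Fintype.card_subtype]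
    simp only [Finset.card_def, Finset.filter_val, eq_comm (b := w)]
    exact this.symm
  refine ⟨Equiv.ofFiberEquiv (f := z) (g := d) fun w => Fintype.equivOfCardEq (hc w), fun i => ?_⟩
  exact Equiv.ofFiberEquiv_map _ i

theorem inner_toEuclideanLin {n : ℕ} {C : Matrix (Fin n) (Fin n) ℂ} (hC : Cᴴ * C = 1)
    (v w : EuclideanSpace ℂ (Fin n)) :
    inner ℂ (Matrix.toEuclideanLin C v) (Matrix.toEuclideanLin C w) = inner ℂ v w := by
  rw [EuclideanSpace.inner_eq_star_dotProduct, EuclideanSpace.inner_eq_star_dotProduct]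
  simp only [Matrix.toLpLin_apply]
  rw [Matrix.star_mulVec, dotProduct_comm, ← Matrix.dotProduct_mulVec, Matrix.mulVec_mulVec, hC,
    Matrix.one_mulVec, dotProduct_comm]

/-- The orthogonal complement of an invariant subspace `p` is invariant: the isometry is injective,
hence maps the finite-dimensional `p` onto itself, so every `w ∈ p` is `T w'` with `w' ∈ p`. -/
theorem isSemisimple_of_inner_map {E : Type*} [NormedAddCommGroup E] [InnerProductSpace ℂ E]
    [FiniteDimensional ℂ E] (T : Module.End ℂ E)
    (hT : ∀ v w, inner ℂ (T v) (T w) = inner ℂ v w) : T.IsSemisimple := by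
  rw [Module.End.isSemisimple_iff]
  intro p hp
  refine ⟨pᗮ, ?_, Submodule.isCompl_orthogonal p⟩
  have hinj : Function.Injective T := by
    rw [injective_iff_map_eq_zero]
    intro v hv
    rw [← inner_self_eq_zero (𝕜 := ℂ), ← hT, hv, inner_zero_left]
  have hp' : ∀ x ∈ p, T x ∈ p := fun x hx => hp hx
  have hs : Function.Surjective (T.restrict hp') := by
    rw [← LinearMap.injective_iff_surjective]
    intro x y hxy
    exact Subtype.ext (hinj (congrArg Subtype.val hxy))
  intro v hv w hw
  obtain ⟨⟨w', hw'⟩, h⟩ := hs ⟨w, hw⟩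
  have h' : T w' = w := congrArg Subtype.val h
  rw [← h', hT]
  exact hv w' hw'

/-- If eigenvectors for `c` and `d` were not orthogonal, preservation of inner products would give
`conj c * c = 1 = conj c * d`, hence `c = d`. -/
theorem orthogonalFamily_eigenspace_of_inner_map {E : Type*} [NormedAddCommGroup E]
    [InnerProductSpace ℂ E] (T : Module.End ℂ E)
    (hT : ∀ v w, inner ℂ (T v) (T w) = inner ℂ v w) :
    OrthogonalFamily ℂ (fun c => Module.End.eigenspace T c)
      fun c => (Module.End.eigenspace T c).subtypeₗᵢ := by
  rintro c d hcd ⟨v, hv⟩ ⟨w, hw⟩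
  rw [Module.End.mem_eigenspace_iff] at hv hw
  change inner ℂ v w = 0
  by_contra hne
  have hv0 : inner ℂ v v ≠ (0 : ℂ) := by
    intro h0
    rw [inner_self_eq_zero] at h0
    exact hne (by rw [h0, inner_zero_left])
  have h1 : conj c * c = 1 := by
    have := hT v v
    rw [hv, inner_smul_left, inner_smul_right, ← mul_assoc] at this
    exact mul_right_cancel₀ hv0 (by rw [this, one_mul])
  have h2 : conj c * d = 1 := by
    have := hT v w
    rw [hv, hw, inner_smul_left, inner_smul_right, ← mul_assoc] at this
    exact mul_right_cancel₀ hne (by rw [this, one_mul])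
  exact hcd (mul_left_cancel₀ (left_ne_zero_of_mul_eq_one h1) (h1.trans h2.symm))

theorem exists_unitary_diagonalization {n : ℕ} {C : Matrix (Fin n) (Fin n) ℂ} (hC : Cᴴ * C = 1)
    {z : Fin n → ℂ} (hz : C.charpoly = ∏ j, (Polynomial.X - Polynomial.C (z j))) :
    ∃ Q : Matrix (Fin n) (Fin n) ℂ, Qᴴ * Q = 1 ∧ C * Q = Q * Matrix.diagonal z := by
  classical
  set T : Module.End ℂ (EuclideanSpace ℂ (Fin n)) := Matrix.toEuclideanLin C with hTdef
  have hT : ∀ v w, inner ℂ (T v) (T w) = inner ℂ v w := inner_toEuclideanLin hC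
  have hfam : OrthogonalFamily ℂ (fun c : Module.End.Eigenvalues T => Module.End.eigenspace T c)
      fun c => (Module.End.eigenspace T c).subtypeₗᵢ :=
    (orthogonalFamily_eigenspace_of_inner_map T hT).comp Subtype.coe_injective
  have hint : DirectSum.IsInternal
      (fun c : Module.End.Eigenvalues T => Module.End.eigenspace T (c : ℂ)) := by
    rw [hfam.isInternal_iff, Submodule.orthogonal_eq_bot_iff, eq_top_iff,
      ← (isSemisimple_of_inner_map T hT).iSup_eigenspace_eq_top]
    refine iSup_le fun c => ?_
    by_cases h : T.HasEigenvalue c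
    · exact le_iSup (fun c : Module.End.Eigenvalues T => Module.End.eigenspace T (c : ℂ)) ⟨c, h⟩
    · have : Module.End.eigenspace T c = ⊥ := by
        simpa [Module.End.hasEigenvalue_iff] using h
      simp [this]
  have hn : Module.finrank ℂ (EuclideanSpace ℂ (Fin n)) = n := by simp
  let b := hint.subordinateOrthonormalBasis hn hfam
  let d : Fin n → ℂ := fun i =>
    (hint.subordinateOrthonormalBasisIndex hn i hfam : Module.End.Eigenvalues T)
  have hb : ∀ i, T (b i) = d i • b i := fun i =>
    Module.End.mem_eigenspace_iff.1 (hint.subordinateOrthonormalBasis_subordinate hn i hfam)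
  -- This is used twice: for the basis in whatever order it comes, which yields the characteristic
  -- polynomial, and then for the basis reindexed so that the eigenvalues appear in the prescribed
  -- order `z`.
  have key : ∀ (b : OrthonormalBasis (Fin n) ℂ (EuclideanSpace ℂ (Fin n))) (d : Fin n → ℂ),
      (∀ i, T (b i) = d i • b i) → ∃ Q : Matrix (Fin n) (Fin n) ℂ, Qᴴ * Q = 1 ∧
        C * Q = Q * Matrix.diagonal d := by
    intro b d hb
    refine ⟨Matrix.of fun i j => b j i, ?_, ?_⟩
    · ext i j
      have := orthonormal_iff_ite.1 b.orthonormal i j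
      rw [EuclideanSpace.inner_eq_star_dotProduct] at this
      rw [Matrix.one_apply, ← this]
      simp [Matrix.mul_apply, dotProduct, mul_comm]
    · ext i j
      have := congrArg (fun v : EuclideanSpace ℂ (Fin n) => v i) (hb j)
      simp only [hTdef, Matrix.toLpLin_apply, PiLp.smul_apply, smul_eq_mul] at this
      rw [Matrix.mul_diagonal]
      simp only [Matrix.of_apply]
      rw [mul_comm, ← this]
      rfl
  obtain ⟨Q, hQ, hCQ⟩ := key b d hb
  have hQ' : Q * Qᴴ = 1 := mul_eq_one_comm.1 hQ
  have hch : C.charpoly = ∏ j, (Polynomial.X - Polynomial.C (d j)) := by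
    rw [← Matrix.charpoly_diagonal]
    have : C = Q * (Matrix.diagonal d * Qᴴ) := by
      rw [← mul_assoc, ← hCQ, mul_assoc, hQ', mul_one]
    rw [this, Matrix.charpoly_mul_comm, mul_assoc, hQ, mul_one]
  obtain ⟨σ, hσ⟩ := exists_perm_of_prod_X_sub_C_eq (hch.symm.trans hz)
  refine key (b.reindex σ.symm) z fun i => ?_
  simp only [OrthonormalBasis.reindex_apply, Equiv.symm_symm]
  rw [hb, hσ]

/-! ### Recursive structure of CMV matrices -/

/-- The block matrix `diag(1, N)`. -/
def oneBlock {n : ℕ} (N : Matrix (Fin n) (Fin n) ℂ) : Matrix (Fin (n + 1)) (Fin (n + 1)) ℂ :=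
  Matrix.of fun i j =>
    Fin.cases (Fin.cases 1 (fun _ => 0) j) (fun i' => Fin.cases 0 (fun j' => N i' j') j) i

section oneBlock
variable {n : ℕ} (N P : Matrix (Fin n) (Fin n) ℂ)

@[simp] theorem oneBlock_zero_zero : oneBlock N 0 0 = 1 := rfl
@[simp] theorem oneBlock_zero_succ (j : Fin n) : oneBlock N 0 j.succ = 0 := rfl
@[simp] theorem oneBlock_succ_zero (i : Fin n) : oneBlock N i.succ 0 = 0 := rfl
@[simp] theorem oneBlock_succ_succ (i j : Fin n) : oneBlock N i.succ j.succ = N i j := rfl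

@[simp] theorem oneBlock_one_zero (N : Matrix (Fin (n + 1)) (Fin (n + 1)) ℂ) :
    oneBlock N 1 0 = 0 := rfl

@[simp] theorem oneBlock_zero_one (N : Matrix (Fin (n + 1)) (Fin (n + 1)) ℂ) :
    oneBlock N 0 1 = 0 := rfl

theorem oneBlock_mul : oneBlock (N * P) = oneBlock N * oneBlock P := by
  ext i j
  refine Fin.cases ?_ (fun i => ?_) i <;> refine Fin.cases ?_ (fun j => ?_) j <;>
    simp [Matrix.mul_apply, Fin.sum_univ_succ]

theorem oneBlock_conjTranspose : (oneBlock N)ᴴ = oneBlock Nᴴ := by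
  ext i j
  refine Fin.cases ?_ (fun i => ?_) i <;> refine Fin.cases ?_ (fun j => ?_) j <;> simp

theorem oneBlock_one : oneBlock (1 : Matrix (Fin n) (Fin n) ℂ) = 1 := by
  ext i j
  refine Fin.cases ?_ (fun i => ?_) i <;> refine Fin.cases ?_ (fun j => ?_) j <;>
    simp [Matrix.one_apply, (Fin.succ_ne_zero _).symm]

theorem oneBlock_injective : Function.Injective (oneBlock (n := n)) := by
  intro N P h
  ext i j
  rw [← oneBlock_succ_succ N, h, oneBlock_succ_succ]

theorem det_oneBlock : (oneBlock N).det = N.det := by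
  rw [Matrix.det_succ_row_zero, Fin.sum_univ_succ]
  simp only [oneBlock_zero_zero, oneBlock_zero_succ, mul_zero, zero_mul, Finset.sum_const_zero]
  simp only [Fin.val_zero, pow_zero, one_mul, add_zero]
  congr 1

end oneBlock

/-- The matrix `diag(Ξ, 1)` with `Ξ = [[conj a, ρ], [ρ, -a]]`. -/
def xiBlock (n : ℕ) (a : ℂ) : Matrix (Fin (n + 2)) (Fin (n + 2)) ℂ :=
  Matrix.of fun i j =>
    if i = 0 then if j = 0 then conj a else if j = 1 then (rho a : ℂ) else 0
    else if i = 1 then if j = 0 then (rho a : ℂ) else if j = 1 then -a else 0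
    else if i = j then 1 else 0

theorem rho_mul_self {a : ℂ} (ha : ‖a‖ ≤ 1) : (rho a : ℂ) * rho a = 1 - conj a * a := by
  rw [← Complex.normSq_eq_conj_mul_self, Complex.normSq_eq_norm_sq, ← Complex.ofReal_mul, rho,
    Real.mul_self_sqrt (by nlinarith [norm_nonneg a])]
  push_cast
  rfl

theorem rho_pos {a : ℂ} (ha : ‖a‖ < 1) : 0 < rho a :=
  Real.sqrt_pos.2 (by nlinarith [norm_nonneg a])

@[simp] theorem succ_succ_eq_one_iff {n : ℕ} (x : Fin n) : x.succ.succ = 1 ↔ False := by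
  simp [Fin.ext_iff]

@[simp] theorem one_eq_succ_succ_iff {n : ℕ} (x : Fin n) : 1 = x.succ.succ ↔ False := by
  simp [Fin.ext_iff]

section xiBlock
variable {n : ℕ} (a : ℂ) (X : Matrix (Fin (n + 2)) (Fin (n + 2)) ℂ)

theorem xiBlock_mul_zero (j : Fin (n + 2)) :
    (xiBlock n a * X) 0 j = conj a * X 0 j + rho a * X 1 j := by
  rw [Matrix.mul_apply, Fin.sum_univ_succ, Fin.sum_univ_succ]
  simp [xiBlock]

theorem xiBlock_mul_one (j : Fin (n + 2)) :
    (xiBlock n a * X) 1 j = rho a * X 0 j - a * X 1 j := by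
  rw [Matrix.mul_apply, Fin.sum_univ_succ, Fin.sum_univ_succ]
  simp [xiBlock, sub_eq_add_neg]

theorem xiBlock_mul_succ_succ (i : Fin n) (j : Fin (n + 2)) :
    (xiBlock n a * X) i.succ.succ j = X i.succ.succ j := by
  rw [Matrix.mul_apply, Finset.sum_eq_single i.succ.succ]
  · simp [xiBlock]
  · intro m _ hm
    simp [xiBlock, hm.symm]
  · simp

theorem xiBlock_conjTranspose : (xiBlock n a)ᴴ = xiBlock n (conj a) := by
  ext i j
  simp only [Matrix.conjTranspose_apply, xiBlock, Matrix.of_apply]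
  refine Fin.cases ?_ (fun i => Fin.cases ?_ (fun i => ?_) i) i <;>
  refine Fin.cases ?_ (fun j => Fin.cases ?_ (fun j => ?_) j) j <;>
    simp only [rho, Fin.succ_zero_eq_one, succ_succ_eq_one_iff, one_eq_succ_succ_iff, if_true,
      if_false, Fin.succ_ne_zero, one_ne_zero, zero_ne_one, (Fin.succ_ne_zero _).symm, star_zero,
      RCLike.star_def, RCLike.conj_conj, RCLike.norm_conj, Complex.conj_ofReal, map_neg,
      Fin.succ_inj]
  split_ifs with h1 h2 h2
  · simp
  · exact absurd h1.symm h2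
  · exact absurd h2.symm h1
  · simp

theorem xiBlock_mul_xiBlock_conj {a : ℂ} (ha : ‖a‖ ≤ 1) : xiBlock n a * xiBlock n (conj a) = 1 := by
  have h := rho_mul_self ha
  have hr : rho (conj a) = rho a := by simp [rho]
  have h01 : (1 : Matrix (Fin (n + 2)) (Fin (n + 2)) ℂ) 0 1 = 0 := by simp
  have h11 : (1 : Matrix (Fin (n + 2)) (Fin (n + 2)) ℂ) 1 1 = 1 := by simp
  have h10 : (1 : Matrix (Fin (n + 2)) (Fin (n + 2)) ℂ) 1 0 = 0 := by simp
  ext i j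
  refine Fin.cases ?_ (fun i => Fin.cases ?_ (fun i => ?_) i) i
  · rw [xiBlock_mul_zero]
    refine Fin.cases ?_ (fun j => Fin.cases ?_ (fun j => ?_) j) j
    · simp [xiBlock, hr, h]
    · rw [Fin.succ_zero_eq_one, h01]
      simp [xiBlock, hr]
      ring
    · simp [xiBlock, (Fin.succ_ne_zero _).symm]
  · rw [Fin.succ_zero_eq_one, xiBlock_mul_one]
    refine Fin.cases ?_ (fun j => Fin.cases ?_ (fun j => ?_) j) j
    · rw [h10]
      simp [xiBlock, hr]
      ring
    · rw [Fin.succ_zero_eq_one, h11]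
      simp [xiBlock, hr, h]
      ring
    · rw [Matrix.one_apply_ne (by simp)]
      simp [xiBlock]
  · rw [xiBlock_mul_succ_succ]
    simp [xiBlock, Matrix.one_apply]

theorem xiBlock_conjTranspose_mul {a : ℂ} (ha : ‖a‖ ≤ 1) : (xiBlock n a)ᴴ * xiBlock n a = 1 := by
  rw [xiBlock_conjTranspose, mul_eq_one_comm]
  exact xiBlock_mul_xiBlock_conj ha

theorem det_xiBlock {a : ℂ} (ha : ‖a‖ ≤ 1) : (xiBlock n a).det = -1 := by
  have h := rho_mul_self ha
  have h0 : (xiBlock n a).submatrix Fin.succ (Fin.succAbove 0) = Matrix.diagonal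
      (fun i : Fin (n + 1) => if i = 0 then -a else 1) := by
    ext i j
    refine Fin.cases ?_ (fun i => ?_) i <;> refine Fin.cases ?_ (fun j => ?_) j <;>
      simp [xiBlock, Matrix.diagonal_apply, (Fin.succ_ne_zero _).symm]
  have h1 : (xiBlock n a).submatrix Fin.succ (Fin.succAbove 1) = Matrix.diagonal
      (fun i : Fin (n + 1) => if i = 0 then (rho a : ℂ) else 1) := by
    ext i j
    refine Fin.cases ?_ (fun i => ?_) i <;> refine Fin.cases ?_ (fun j => ?_) j <;>
      simp [xiBlock, Matrix.diagonal_apply, (Fin.succ_ne_zero _).symm]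
  have hp : ∀ c : ℂ, ∏ i : Fin (n + 1), (if i = 0 then c else 1) = c := by
    intro c
    simp
  rw [Matrix.det_succ_row_zero, Fin.sum_univ_succ, Fin.sum_univ_succ, Fin.succ_zero_eq_one, h0, h1,
    Matrix.det_diagonal, Matrix.det_diagonal, hp, hp, Finset.sum_eq_zero]
  · simp [xiBlock, h]
    ring
  · intro x _
    simp [xiBlock]

end xiBlock

section recursion
variable {n : ℕ} (a : ℂ)

theorem blockFactor_one_cons (α : Fin n → ℂ) :
    blockFactor 1 (Fin.cons a α : Fin (n + 1) → ℂ) = oneBlock (blockFactor 0 α) := by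
  ext i j
  refine Fin.cases ?_ (fun i => ?_) i <;> refine Fin.cases ?_ (fun j => ?_) j
  · simp [blockFactor]
  · simp [blockFactor, (Fin.succ_ne_zero _).symm]
  · simp [blockFactor]
  · obtain ⟨i, hi⟩ := i
    obtain ⟨j, hj⟩ := j
    rw [oneBlock_succ_succ]
    simp only [blockFactor, Matrix.of_apply, Fin.succ_mk, Fin.mk.injEq]
    rcases i with _ | i <;> split_ifs <;> first | (exfalso; omega) | rfl | simp_all

theorem blockFactor_zero_cons (α : Fin (n + 1) → ℂ) :
    blockFactor 0 (Fin.cons a α : Fin (n + 2) → ℂ) = xiBlock n a * oneBlock (blockFactor 1 α) := by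
  ext i j
  refine Fin.cases ?_ (fun i => Fin.cases ?_ (fun i => ?_) i) i
  · rw [xiBlock_mul_zero, ← Fin.succ_zero_eq_one]
    refine Fin.cases ?_ (fun j => Fin.cases ?_ (fun j => ?_) j) j
    · simp [blockFactor]
    · rw [oneBlock_succ_succ]
      simp [blockFactor]
    · rw [oneBlock_succ_succ]
      simp [blockFactor, (Fin.succ_ne_zero _).symm]
  · rw [Fin.succ_zero_eq_one, xiBlock_mul_one, ← Fin.succ_zero_eq_one]
    refine Fin.cases ?_ (fun j => Fin.cases ?_ (fun j => ?_) j) j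
    · simp [blockFactor]
    · rw [oneBlock_succ_succ]
      simp [blockFactor]
    · rw [oneBlock_succ_succ]
      simp [blockFactor, (Fin.succ_ne_zero _).symm]
  · rw [xiBlock_mul_succ_succ]
    refine Fin.cases ?_ (fun j => ?_) j
    · simp [blockFactor]
    · obtain ⟨i, hi⟩ := i
      obtain ⟨j, hj⟩ := j
      rw [oneBlock_succ_succ]
      simp only [blockFactor, Matrix.of_apply, Fin.succ_mk, Fin.mk.injEq]
      split_ifs <;> first | (exfalso; omega) | rfl

theorem blockFactor_transpose (p : ℕ) (α : Fin n → ℂ) : (blockFactor p α)ᵀ = blockFactor p α := by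
  ext i j
  simp only [Matrix.transpose_apply, blockFactor, Matrix.of_apply]
  by_cases h : i = j
  · subst h; rfl
  · rw [if_neg h, if_neg (Ne.symm h)]
    split_ifs <;> first | (exfalso; omega) | rfl

theorem cmv_transpose (α : Fin n → ℂ) : (cmv α)ᵀ = blockFactor 1 α * blockFactor 0 α := by
  rw [cmv, Matrix.transpose_mul, blockFactor_transpose, blockFactor_transpose]

/-- Removing the first coefficient shifts the blocks by one place and thereby exchanges the roles of
the two factors `L` and `M`; this is why a transpose appears. All inductions on CMV matrices rest on
this recursion. -/
theorem cmv_cons (α : Fin (n + 1) → ℂ) :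
    cmv (Fin.cons a α : Fin (n + 2) → ℂ) = xiBlock n a * oneBlock (cmv α)ᵀ := by
  rw [cmv_transpose, oneBlock_mul, ← mul_assoc, ← blockFactor_zero_cons, ← blockFactor_one_cons]
  rfl

theorem cmv_fin_one (α : Fin 1 → ℂ) : cmv α = Matrix.of fun _ _ => conj (α 0) := by
  ext i j
  fin_cases i
  fin_cases j
  simp [cmv, blockFactor, Matrix.mul_apply]

/-- The determinant of a CMV matrix; nothing is assumed about the last coefficient. -/
theorem det_cmv : ∀ {n : ℕ} (α : Fin (n + 1) → ℂ), (∀ j : Fin n, ‖α j.castSucc‖ ≤ 1) →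
    (cmv α).det = (-1) ^ n * conj (α (Fin.last n))
  | 0, α, _ => by
    rw [cmv_fin_one]
    simp
  | n + 1, α, h => by
    obtain ⟨a, β, rfl⟩ : ∃ a β, α = Fin.cons a β := ⟨_, _, (Fin.cons_self_tail α).symm⟩
    rw [cmv_cons, Matrix.det_mul, det_oneBlock, Matrix.det_transpose,
      det_cmv β (fun j => by simpa using h j.succ), det_xiBlock (by simpa using h 0),
      ← Fin.succ_last, Fin.cons_succ]
    ring

theorem conjTranspose_mul_cmv : ∀ {n : ℕ} {α : Fin (n + 1) → ℂ}, IsVerblunsky α →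
    (cmv α)ᴴ * cmv α = 1
  | 0, α, h => by
    have h0 : ‖α 0‖ = 1 := by simpa using h 0
    rw [cmv_fin_one]
    ext i j
    fin_cases i
    fin_cases j
    simp [Matrix.mul_apply, Complex.mul_conj, Complex.normSq_eq_norm_sq, h0]
  | n + 1, α, h => by
    obtain ⟨a, β, rfl⟩ : ∃ a β, α = Fin.cons a β := ⟨_, _, (Fin.cons_self_tail α).symm⟩
    have ha : ‖a‖ < 1 := by simpa using h 0
    have hβ : IsVerblunsky β := by
      intro j
      have := h j.succ
      simpa using this
    have h1 := conjTranspose_mul_cmv hβ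
    have h2 : ((cmv β)ᵀ)ᴴ * (cmv β)ᵀ = 1 := by
      change ((cmv β)ᴴ)ᵀ * (cmv β)ᵀ = 1
      rw [← Matrix.transpose_mul, mul_eq_one_comm.1 h1, Matrix.transpose_one]
    rw [cmv_cons, Matrix.conjTranspose_mul, mul_assoc, ← mul_assoc (xiBlock n a)ᴴ,
      xiBlock_conjTranspose_mul ha.le, one_mul, oneBlock_conjTranspose, ← oneBlock_mul, h2,
      oneBlock_one]

end recursion

/-! ### The shape of CMV matrices -/

open scoped ComplexOrder in
/-- The upper half of the CMV shape: the entries beyond the staircase vanish, and those at its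
corners are positive. The parity `p` tells which rows `i` reach up to the column `i + 2`. -/
structure IsShape {n : ℕ} (p : ℕ) (B : Matrix (Fin n) (Fin n) ℂ) : Prop where
  far : ∀ i j : Fin n, i.val + 2 < j.val → B i j = 0
  near : ∀ i j : Fin n, j.val = i.val + 2 → i.val % 2 ≠ p % 2 → B i j = 0
  pos : ∀ i j : Fin n, j.val = i.val + 2 → i.val % 2 = p % 2 → 0 < B i j
  first : p % 2 = 1 → ∀ i j : Fin n, i.val = 0 → j.val = 1 → 0 < B i j

theorem blockFactor_eq_zero {n : ℕ} (p : ℕ) (α : Fin n → ℂ) {i j : Fin n} (h : i.val ≠ j.val)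
    (h1 : i.val + 1 = j.val → i.val % 2 ≠ p % 2) (h2 : j.val + 1 = i.val → j.val % 2 ≠ p % 2) :
    blockFactor p α i j = 0 := by
  simp only [blockFactor, Matrix.of_apply, Fin.ext_iff]
  rw [if_neg h, if_neg (fun hh => h1 hh.1 hh.2), if_neg (fun hh => h2 hh.1 hh.2)]

theorem blockFactor_upper {n : ℕ} (p : ℕ) (α : Fin n → ℂ) {i j : Fin n} (h : i.val + 1 = j.val)
    (h1 : i.val % 2 = p % 2) : blockFactor p α i j = rho (α i) := by
  simp only [blockFactor, Matrix.of_apply, Fin.ext_iff]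
  rw [if_neg (by omega), if_pos ⟨h, h1⟩]

/-- The blocks of the two factors are staggered, so the only path from `i` to `i + 2` goes through
`i + 1`, and only for one parity of `i`. The corner entry is then a product of two numbers `ρ > 0`.
-/
theorem blockFactor_mul_isShape {n : ℕ} {α : Fin n → ℂ} (hα : IsVerblunsky α) {p q : ℕ}
    (hpq : p % 2 ≠ q % 2) : IsShape p (blockFactor p α * blockFactor q α) := by
  have hr : ∀ i : Fin n, i.val + 1 < n → (0 : ℝ) < rho (α i) := fun i hi =>
    rho_pos (by simpa [hi] using hα i)
  refine ⟨fun i j h => ?_, fun i j h hi => ?_, fun i j h hi => ?_, fun hp i j hi hj => ?_⟩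
  · rw [Matrix.mul_apply]
    refine Finset.sum_eq_zero fun m _ => ?_
    by_cases hm : m.val ≤ i.val + 1
    · exact mul_eq_zero_of_right _
        (blockFactor_eq_zero _ _ (by omega) (by omega) (by omega))
    · exact mul_eq_zero_of_left
        (blockFactor_eq_zero _ _ (by omega) (by omega) (by omega)) _
  · rw [Matrix.mul_apply]
    refine Finset.sum_eq_zero fun m _ => ?_
    by_cases hm : m.val ≤ i.val
    · exact mul_eq_zero_of_right _
        (blockFactor_eq_zero _ _ (by omega) (by omega) (by omega))
    · exact mul_eq_zero_of_left
        (blockFactor_eq_zero _ _ (by omega) (by omega) (by omega)) _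
  · rw [Matrix.mul_apply, Finset.sum_eq_single (⟨i.val + 1, by omega⟩ : Fin n)]
    · rw [blockFactor_upper p α rfl hi, blockFactor_upper q α (by simp; omega) (by simp; omega)]
      have := mul_pos (hr i (by omega)) (hr ⟨i.val + 1, by omega⟩ (by simp; omega))
      exact_mod_cast this
    · intro m _ hm
      have hm' : m.val ≠ i.val + 1 := fun h => hm (Fin.ext h)
      by_cases hm : m.val ≤ i.val
      · exact mul_eq_zero_of_right _
          (blockFactor_eq_zero _ _ (by omega) (by omega) (by omega))
      · exact mul_eq_zero_of_left
          (blockFactor_eq_zero _ _ (by omega) (by omega) (by omega)) _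
    · simp
  · rw [Matrix.mul_apply, Finset.sum_eq_single i]
    · have h1 : blockFactor p α i i = 1 := by simp [blockFactor, hi, hp]
      rw [h1, one_mul, blockFactor_upper q α (by omega) (by omega)]
      exact_mod_cast hr i (by omega)
    · intro m _ hm
      have hm' : m.val ≠ i.val := fun h => hm (Fin.ext h)
      exact mul_eq_zero_of_left
        (blockFactor_eq_zero _ _ (by omega) (by omega) (by omega)) _
    · simp

theorem cmv_isShape {n : ℕ} {α : Fin n → ℂ} (hα : IsVerblunsky α) : IsShape 0 (cmv α) :=
  blockFactor_mul_isShape hα (by norm_num)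

theorem cmv_transpose_isShape {n : ℕ} {α : Fin n → ℂ} (hα : IsVerblunsky α) :
    IsShape 1 (cmv α)ᵀ :=
  cmv_transpose α ▸ blockFactor_mul_isShape hα (by norm_num)

/-- The leading `k × k` submatrix of a CMV matrix is the CMV matrix of the first `k`
coefficients. -/
theorem cmv_submatrix_castLE {n k : ℕ} (hk : k ≤ n) (α : Fin n → ℂ) :
    (cmv α).submatrix (Fin.castLE hk) (Fin.castLE hk) = cmv fun i => α (Fin.castLE hk i) := by
  have hb : ∀ p (i j : Fin k), blockFactor p α (Fin.castLE hk i) (Fin.castLE hk j)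
      = blockFactor p (fun i => α (Fin.castLE hk i)) i j := by
    intro p i j
    simp only [blockFactor, Matrix.of_apply, Fin.ext_iff, Fin.val_castLE]
    rfl
  ext i j
  rw [Matrix.submatrix_apply, cmv, cmv, Matrix.mul_apply, Matrix.mul_apply]
  symm
  refine Fintype.sum_of_injective (Fin.castLE hk) (Fin.castLE_injective hk) _ _ ?_ ?_
  · intro m hm
    have hm' : k ≤ m.val := by
      by_contra hlt
      exact hm ⟨⟨m.val, by omega⟩, rfl⟩
    have hi := i.isLt
    have hj := j.isLt
    -- At most one `2 × 2` block straddles the cut after the first `k` indices, and it belongs to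
    -- only one of the two factors. A path that leaves the leading block can therefore not return.
    by_cases hmi : m.val = i.val + 1 ∧ i.val % 2 = 0
    · exact mul_eq_zero_of_right _ (blockFactor_eq_zero _ _ (by simp; omega) (by simp; omega)
        (by simp; omega))
    · exact mul_eq_zero_of_left (blockFactor_eq_zero _ _ (by simp; omega) (by simp; omega)
        (by simp; omega)) _
  · intro m
    rw [hb, hb]

/-- This is how a coefficient is recovered from the matrix. The truncation is built like a CMV
matrix, but its last coefficient may lie inside the disk, so the determinant formula must leave that
coefficient unrestricted. -/
theorem det_leading_cmv {n : ℕ} {α : Fin n → ℂ} (hα : IsVerblunsky α) (a : Fin n)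
    (ha : a.val + 1 ≤ n) :
    ((cmv α).submatrix (Fin.castLE ha) (Fin.castLE ha)).det = (-1) ^ a.val * conj (α a) := by
  rw [cmv_submatrix_castLE, det_cmv]
  · rfl
  · intro j
    have := hα (Fin.castLE ha j.castSucc)
    split_ifs at this
    exacts [this.le, this.le]

open scoped ComplexOrder in
/-- A unitary matrix of the CMV shape is a CMV matrix. -/
theorem exists_eq_cmv : ∀ {n : ℕ} {B : Matrix (Fin (n + 1)) (Fin (n + 1)) ℂ}, Bᴴ * B = 1 →
    IsShape 0 B → IsShape 1 Bᵀ → ∃ α, IsVerblunsky α ∧ B = cmv α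
  | 0, B, hB, _, _ => by
    refine ⟨fun _ => conj (B 0 0), fun j => ?_, ?_⟩
    · have := congrFun (congrFun hB 0) 0
      simp only [Matrix.mul_apply, Fin.sum_univ_succ, Matrix.conjTranspose_apply,
        Finset.univ_eq_empty, Finset.sum_empty, add_zero, Matrix.one_apply_eq] at this
      rw [RCLike.star_def, ← Complex.normSq_eq_conj_mul_self, Complex.normSq_eq_norm_sq] at this
      have h1 : ‖B 0 0‖ ^ 2 = 1 := by exact_mod_cast this
      have h2 : ‖B 0 0‖ = 1 := by
        exact (pow_eq_one_iff_of_nonneg (norm_nonneg _) two_ne_zero).1 h1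
      simp [h2]
    · rw [cmv_fin_one]
      ext i j
      fin_cases i
      fin_cases j
      simp
  | n + 1, B, hB, h0, h1 => by
    -- The first column of a matrix `xiBlock n a * oneBlock N` is `(conj a, ρ, 0, …)`, which forces
    -- this choice of `a`. The shape leaves only two entries in that column, and their squares add
    -- up to `1`.
    set a : ℂ := conj (B 0 0) with ha
    have hpos : 0 < B 1 0 := h1.first rfl 0 1 rfl rfl
    have hcol : ∀ i : Fin n, B i.succ.succ 0 = 0 := by
      intro i
      rcases Nat.eq_zero_or_pos i.val with hi | hi
      · exact h1.near 0 i.succ.succ (by simp [hi]) (by simp)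
      · exact h1.far 0 i.succ.succ (by simp; omega)
    have hnorm : ‖B 0 0‖ ^ 2 + ‖B 1 0‖ ^ 2 = 1 := by
      have := congrFun (congrFun hB 0) 0
      simp only [Matrix.mul_apply, Fin.sum_univ_succ, Matrix.conjTranspose_apply,
        hcol, mul_zero, Finset.sum_const_zero, add_zero, Matrix.one_apply_eq,
        Fin.succ_zero_eq_one] at this
      rw [RCLike.star_def, ← Complex.normSq_eq_conj_mul_self,
        ← Complex.normSq_eq_conj_mul_self, Complex.normSq_eq_norm_sq,
        Complex.normSq_eq_norm_sq] at this
      exact_mod_cast this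
    have hn1 : 0 < ‖B 1 0‖ := norm_pos_iff.2 hpos.ne'
    have haB : ‖a‖ = ‖B 0 0‖ := RCLike.norm_conj _
    have ha1 : ‖a‖ < 1 := by
      rw [haB]
      nlinarith [norm_nonneg (B 0 0)]
    have hrho : B 1 0 = rho a := by
      have h2 : rho a = ‖B 1 0‖ := by
        rw [rho, haB, ← hnorm, add_sub_cancel_left, Real.sqrt_sq hn1.le]
      rw [h2]
      exact Complex.eq_coe_norm_of_nonneg hpos.le
    have hr := rho_pos ha1
    have hX := xiBlock_conjTranspose_mul (n := n) ha1.le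
    have hX' : xiBlock n a * (xiBlock n a)ᴴ = 1 := mul_eq_one_comm.1 hX
    set D := (xiBlock n a)ᴴ * B with hD
    have hBD : B = xiBlock n a * D := by rw [hD, ← mul_assoc, hX', one_mul]
    have hDu : Dᴴ * D = 1 := by
      rw [hD, Matrix.conjTranspose_mul, Matrix.conjTranspose_conjTranspose, mul_assoc,
        ← mul_assoc (xiBlock n a), hX', one_mul, hB]
    have hDcol : ∀ i, D i 0 = (1 : Matrix (Fin (n + 2)) (Fin (n + 2)) ℂ) i 0 := by
      intro i
      rw [← hX, hD, Matrix.mul_apply, Matrix.mul_apply]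
      refine Finset.sum_congr rfl fun m _ => ?_
      congr 1
      refine Fin.cases ?_ (fun m => Fin.cases ?_ (fun m => ?_) m) m
      · simp [xiBlock, ha]
      · simpa [xiBlock] using hrho
      · simpa [xiBlock] using hcol m
    -- The corner of `D` is already `1`, so the unit length of row `0` leaves nothing for its other
    -- entries.
    have hDrow : ∀ j : Fin (n + 1), D 0 j.succ = 0 := by
      have hDu' : D * Dᴴ = 1 := mul_eq_one_comm.1 hDu
      have h00 := congrFun (congrFun hDu' 0) 0
      intro j
      have hs : ∑ m : Fin (n + 1), ‖D 0 m.succ‖ ^ 2 = 0 := by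
        rw [Matrix.mul_apply, Fin.sum_univ_succ] at h00
        simp only [Matrix.conjTranspose_apply, hDcol, Matrix.one_apply_eq, star_one, mul_one,
          RCLike.star_def, Complex.mul_conj, Complex.normSq_eq_norm_sq] at h00
        have : (1 : ℝ) + ∑ m : Fin (n + 1), ‖D 0 m.succ‖ ^ 2 = 1 := by exact_mod_cast h00
        linarith
      rw [Finset.sum_eq_zero_iff_of_nonneg (fun _ _ => by positivity)] at hs
      simpa using hs j (Finset.mem_univ _)
    set N : Matrix (Fin (n + 1)) (Fin (n + 1)) ℂ := D.submatrix Fin.succ Fin.succ with hN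
    have hDN : D = oneBlock N := by
      ext i j
      refine Fin.cases ?_ (fun i => ?_) i <;> refine Fin.cases ?_ (fun j => ?_) j
      · simp [hDcol]
      · simp [hDrow]
      · simp [hDcol]
      · simp [hN]
    have hNu : Nᴴ * N = 1 := by
      apply oneBlock_injective
      rw [oneBlock_mul, ← oneBlock_conjTranspose, ← hDN, hDu, oneBlock_one]
    have hNu' : (Nᵀ)ᴴ * Nᵀ = 1 := by
      change (Nᴴ)ᵀ * Nᵀ = 1
      rw [← Matrix.transpose_mul, mul_eq_one_comm.1 hNu, Matrix.transpose_one]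
    have hNs : ∀ (i : Fin n) (j : Fin (n + 1)), N i.succ j = B i.succ.succ j.succ := by
      intro i j
      rw [hBD, xiBlock_mul_succ_succ]
      rfl
    have hD0 : ∀ j, D 0 j = a * B 0 j + rho a * B 1 j := by
      intro j
      rw [hD, xiBlock_conjTranspose, xiBlock_mul_zero]
      simp [rho]
    have hD1 : ∀ j, D 1 j = rho a * B 0 j - conj a * B 1 j := by
      intro j
      rw [hD, xiBlock_conjTranspose, xiBlock_mul_one]
      simp [rho]
    have hN0 : ∀ j : Fin (n + 1), N 0 j = rho a * B 0 j.succ - conj a * B 1 j.succ :=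
      fun j => hD1 j.succ
    have hNs1 : IsShape 1 N := by
      refine ⟨fun i j h => ?_, fun i j h hi => ?_, fun i j h hi => ?_, fun _ i j hi hj => ?_⟩
      · revert h
        refine Fin.cases (fun h => ?_) (fun i h => ?_) i
        · rw [hN0, h0.far 0 j.succ (by simp at h ⊢; omega),
            h0.far 1 j.succ (by simp at h ⊢; omega)]
          simp
        · rw [hNs]
          exact h0.far _ _ (by simp at h ⊢; omega)
      · revert h hi
        refine Fin.cases (fun h _ => ?_) (fun i h hi => ?_) i
        · rw [hN0, h0.far 0 j.succ (by simp at h ⊢; omega),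
            h0.near 1 j.succ (by simp at h ⊢; omega) (by simp)]
          simp
        · rw [hNs]
          exact h0.near _ _ (by simp at h ⊢; omega) (by simp at hi ⊢; omega)
      · revert h hi
        refine Fin.cases (fun h hi => by simp at hi) (fun i h hi => ?_) i
        rw [hNs]
        exact h0.pos _ _ (by simp at h ⊢; omega) (by simp at hi ⊢; omega)
      · obtain rfl : i = 0 := Fin.ext hi
        have h2 : 0 < B 0 j.succ := h0.pos 0 j.succ (by simp [hj]) (by simp)
        have h3 : D 0 j.succ = 0 := hDrow j
        rw [hD0] at h3
        -- The vanishing of `D 0 j.succ` eliminates row `1` of `B` and leaves a positive multiple of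
        -- the entry `B 0 j.succ`, which is a positive corner.
        have h4 : (rho a : ℂ) * N 0 j = B 0 j.succ := by
          rw [hN0]
          linear_combination (B 0 j.succ) * rho_mul_self ha1.le - conj a * h3
        have hrc : (0 : ℂ) < rho a := by exact_mod_cast hr
        have h5 : N 0 j = ((rho a)⁻¹ : ℝ) * B 0 j.succ := by
          rw [← h4, ← mul_assoc, Complex.ofReal_inv, inv_mul_cancel₀ hrc.ne', one_mul]
        rw [h5]
        exact mul_pos (by exact_mod_cast inv_pos.2 hr) h2
    have hNs0 : IsShape 0 Nᵀ := by
      have hT : ∀ i j : Fin (n + 1), i.val + 2 ≤ j.val → Nᵀ i j = Bᵀ i.succ j.succ := by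
        intro i j h
        obtain ⟨j', rfl⟩ := Fin.exists_succ_eq.2 (show j ≠ 0 by rintro rfl; simp at h)
        exact hNs j' i
      refine ⟨fun i j h => ?_, fun i j h hi => ?_, fun i j h hi => ?_, by simp⟩
      · rw [hT i j h.le]
        exact h1.far _ _ (by simp; omega)
      · rw [hT i j h.ge]
        exact h1.near _ _ (by simp; omega) (by simp at hi ⊢; omega)
      · rw [hT i j h.ge]
        exact h1.pos _ _ (by simp; omega) (by simp at hi ⊢; omega)
    -- The remaining block has the parities of a transposed CMV matrix, so the induction hypothesis
    -- is applied to `Nᵀ`.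
    obtain ⟨β, hβ, hNβ⟩ := exists_eq_cmv hNu' hNs0 (by rwa [Matrix.transpose_transpose])
    refine ⟨Fin.cons a β, fun j => ?_, ?_⟩
    · refine Fin.cases ?_ (fun j => ?_) j
      · simpa using ha1
      · simpa using hβ j
    · rw [cmv_cons, ← hNβ, Matrix.transpose_transpose, ← hDN, ← hBD]

section conjugation
variable {n : ℕ} {p : ℕ} {B W : Matrix (Fin n) (Fin n) ℂ}

-- A lower triangular factor on the left adds to each row only multiples of earlier rows, whose
-- staircase ends further to the left; the corner is just multiplied by a positive diagonal entry.
open scoped ComplexOrder in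
theorem IsShape.lower_mul (hB : IsShape p B) (hW : ∀ i j, i < j → W i j = 0)
    (hd : ∀ i, 0 < W i i) : IsShape p (W * B) := by
  refine ⟨fun i j h => ?_, fun i j h hi => ?_, fun i j h hi => ?_, fun hp i j hi hj => ?_⟩
  · rw [Matrix.mul_apply]
    refine Finset.sum_eq_zero fun m _ => ?_
    rcases lt_or_ge i m with him | him
    · rw [hW i m him, zero_mul]
    · rw [hB.far m j (by have : m.val ≤ i.val := him; omega), mul_zero]
  · rw [Matrix.mul_apply]
    refine Finset.sum_eq_zero fun m _ => ?_
    rcases lt_trichotomy i m with him | him | him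
    · rw [hW i m him, zero_mul]
    · rw [← him, hB.near i j h hi, mul_zero]
    · rw [hB.far m j (by have : m.val < i.val := him; omega), mul_zero]
  · rw [Matrix.mul_apply, Finset.sum_eq_single i]
    · exact mul_pos (hd i) (hB.pos i j h hi)
    · intro m _ hm
      rcases lt_or_gt_of_ne hm with him | him
      · rw [hB.far m j (by have : m.val < i.val := him; omega), mul_zero]
      · rw [hW i m him, zero_mul]
    · simp
  · rw [Matrix.mul_apply, Finset.sum_eq_single i]
    · exact mul_pos (hd i) (hB.first hp i j hi hj)
    · intro m _ hm
      rw [hW i m (lt_of_le_of_ne (by rw [Fin.le_def]; omega) hm.symm), zero_mul]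
    · simp

-- Dually, a lower triangular factor on the right adds to each column only multiples of later
-- columns, which are still zero at the height of the corner.
open scoped ComplexOrder in
theorem IsShape.mul_lower (hB : IsShape p B) (hW : ∀ i j, i < j → W i j = 0)
    (hd : ∀ i, 0 < W i i) : IsShape p (B * W) := by
  refine ⟨fun i j h => ?_, fun i j h hi => ?_, fun i j h hi => ?_, fun hp i j hi hj => ?_⟩
  · rw [Matrix.mul_apply]
    refine Finset.sum_eq_zero fun m _ => ?_
    rcases lt_or_ge m j with him | him
    · rw [hW m j him, mul_zero]
    · rw [hB.far i m (by have : j.val ≤ m.val := him; omega), zero_mul]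
  · rw [Matrix.mul_apply]
    refine Finset.sum_eq_zero fun m _ => ?_
    rcases lt_trichotomy m j with him | him | him
    · rw [hW m j him, mul_zero]
    · rw [him, hB.near i j h hi, zero_mul]
    · rw [hB.far i m (by have : j.val < m.val := him; omega), zero_mul]
  · rw [Matrix.mul_apply, Finset.sum_eq_single j]
    · exact mul_pos (hB.pos i j h hi) (hd j)
    · intro m _ hm
      rcases lt_or_gt_of_ne hm with him | him
      · rw [hW m j him, mul_zero]
      · rw [hB.far i m (by have : j.val < m.val := him; omega), zero_mul]
    · simp
  · rw [Matrix.mul_apply, Finset.sum_eq_single j]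
    · exact mul_pos (hB.first hp i j hi hj) (hd j)
    · intro m _ hm
      rcases lt_or_gt_of_ne hm with him | him
      · rw [hW m j him, mul_zero]
      -- The corner in row `0` exists for odd `p` only, and then row `0` has the parity whose entry
      -- in column `2` vanishes.
      · rcases Nat.lt_or_ge (i.val + 2) m.val with h | h
        · rw [hB.far i m h, zero_mul]
        · rw [hB.near i m (by have : j.val < m.val := him; omega) (by omega), zero_mul]
    · simp

open scoped ComplexOrder in
/-- A lower triangular matrix with a positive diagonal has an inverse of the same kind. -/
theorem exists_lower_inverse (hW : ∀ i j, i < j → W i j = 0) (hd : ∀ i, 0 < W i i) :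
    ∃ V : Matrix (Fin n) (Fin n) ℂ, W * V = 1 ∧ V * W = 1 ∧ (∀ i j, i < j → V i j = 0) ∧
      ∀ i, 0 < V i i := by
  have hdet : IsUnit W.det := by
    rw [Matrix.det_of_isLowerTriangular W (fun i j h => hW i j h), isUnit_iff_ne_zero]
    exact Finset.prod_ne_zero_iff.2 fun i _ => (hd i).ne'
  have hWV := Matrix.mul_nonsing_inv W hdet
  have hVW := Matrix.nonsing_inv_mul W hdet
  have hV : ∀ i j, i < j → W⁻¹ i j = 0 := by
    let := W.invertibleOfIsUnitDet hdet
    have := Matrix.blockTriangular_inv_of_blockTriangular (M := W) (b := OrderDual.toDual)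
      (fun i j h => hW i j h)
    exact fun i j h => this h
  refine ⟨W⁻¹, hWV, hVW, hV, fun i => ?_⟩
  have h1 := congrFun (congrFun hWV i) i
  rw [Matrix.mul_apply, Finset.sum_eq_single i] at h1
  · rw [Matrix.one_apply_eq] at h1
    have h2 : 0 < W i i * W⁻¹ i i := by
      rw [h1]
      exact one_pos
    exact (pos_iff_pos_of_mul_pos h2).1 (hd i)
  · intro m _ hm
    rcases lt_or_gt_of_ne hm with him | him
    · rw [hV m i him, mul_zero]
    · rw [hW i m him, zero_mul]
  · simp

open scoped ComplexOrder in
/-- Conjugation with a lower triangular matrix with positive diagonal preserves the shape. -/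
theorem IsShape.conj_lower {B' : Matrix (Fin n) (Fin n) ℂ} (hB : IsShape p B)
    (hW : ∀ i j, i < j → W i j = 0) (hd : ∀ i, 0 < W i i) (h : B' * W = W * B) :
    IsShape p B' := by
  obtain ⟨V, hWV, -, hV, hVd⟩ := exists_lower_inverse hW hd
  have : B' = W * B * V := by rw [← h, mul_assoc, hWV, mul_one]
  rw [this]
  exact (hB.lower_mul hW hd).mul_lower hV hVd

end conjugation

/-! ### Entrywise derivatives of matrix-valued functions -/

section deriv
variable {n : ℕ}

/-- The entrywise derivative of a matrix-valued function of a real variable. -/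
def HasEntryDeriv (X : ℝ → Matrix (Fin n) (Fin n) ℂ) (X' : Matrix (Fin n) (Fin n) ℂ) (s : Set ℝ)
    (t : ℝ) : Prop :=
  ∀ i j, HasDerivWithinAt (fun u => X u i j) (X' i j) s t

variable {X Y : ℝ → Matrix (Fin n) (Fin n) ℂ} {X' Y' : Matrix (Fin n) (Fin n) ℂ} {s : Set ℝ} {t : ℝ}

theorem hasEntryDeriv_const (M : Matrix (Fin n) (Fin n) ℂ) (s : Set ℝ) (t : ℝ) :
    HasEntryDeriv (fun _ => M) 0 s t :=
  fun _ _ => hasDerivWithinAt_const _ _ _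

theorem HasEntryDeriv.sub (hX : HasEntryDeriv X X' s t) (hY : HasEntryDeriv Y Y' s t) :
    HasEntryDeriv (fun u => X u - Y u) (X' - Y') s t :=
  fun i j => (hX i j).sub (hY i j)

theorem HasEntryDeriv.mul (hX : HasEntryDeriv X X' s t) (hY : HasEntryDeriv Y Y' s t) :
    HasEntryDeriv (fun u => X u * Y u) (X' * Y t + X t * Y') s t := by
  intro i j
  simp only [Matrix.mul_apply, Matrix.add_apply, ← Finset.sum_add_distrib]
  exact HasDerivWithinAt.fun_sum fun m _ => (hX i m).mul (hY m j)

theorem HasEntryDeriv.conjTranspose (hX : HasEntryDeriv X X' s t) :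
    HasEntryDeriv (fun u => (X u)ᴴ) X'ᴴ s t :=
  fun i j => (hX j i).star

theorem HasEntryDeriv.trace_mul (hX : HasEntryDeriv X X' s t) (M : Matrix (Fin n) (Fin n) ℂ) :
    HasDerivWithinAt (fun u => (X u * M).trace) (X' * M).trace s t := by
  have := hX.mul (hasEntryDeriv_const M s t)
  simp only [mul_zero, add_zero] at this
  exact HasDerivWithinAt.fun_sum fun i _ => this i i

theorem eq_of_hasDerivWithinAt_zero {y : ℝ → ℂ}
    (h : ∀ t, 0 ≤ t → HasDerivWithinAt y 0 (Set.Ici 0) t) {t : ℝ} (ht : 0 ≤ t) : y t = y 0 :=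
  constant_of_has_deriv_right_zero
    (fun u hu => ((h u hu.1).continuousWithinAt).mono Set.Icc_subset_Ici_self)
    (fun u hu => (h u hu.1).mono (Set.Ici_subset_Ici.2 hu.1)) t ⟨ht, le_rfl⟩

theorem eq_of_hasEntryDeriv_zero (h : ∀ t, 0 ≤ t → HasEntryDeriv X 0 (Set.Ici 0) t)
    (ht : 0 ≤ t) : X t = X 0 := by
  ext i j
  exact eq_of_hasDerivWithinAt_zero (y := fun u => X u i j) (fun u hu => h u hu i j) ht

end deriv

/-! ### The gradient and the Lax equation -/

section lax
variable {n : ℕ}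

/-- Linear test functions are enough to determine the flow, and for them the gradient represents the
function itself through the pairing. -/
theorem pairing_grad_linear (ψ : Matrix (Fin n) (Fin n) ℂ →ₗ[ℝ] ℝ)
    (B V : Matrix (Fin n) (Fin n) ℂ) : pairing (grad ψ B) V = ψ V := by
  have h : ∀ v, lineDeriv ℝ ψ B v = ψ v := by
    intro v
    have : HasDerivAt (fun t : ℝ => ψ (B + t • v)) (ψ v) 0 := by
      simp only [map_add, map_smul, smul_eq_mul]
      simpa using ((hasDerivAt_id (0 : ℝ)).mul_const (ψ v)).const_add (ψ B)
    exact this.deriv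
  have hV : ∀ l k, ψ (Matrix.single l k (V l k))
      = (V l k).im * ψ (Matrix.single l k Complex.I) + (V l k).re * ψ (Matrix.single l k 1) := by
    intro l k
    rw [← smul_eq_mul, ← smul_eq_mul, ← map_smul, ← map_smul, ← map_add, Matrix.smul_single,
      Matrix.smul_single, ← Matrix.single_add]
    congr 2
    apply Complex.ext <;> simp
  conv_rhs => rw [Matrix.matrix_eq_sum_single V]
  simp only [map_sum, hV]
  rw [Finset.sum_comm]
  simp only [pairing, Matrix.trace, Matrix.diag, Matrix.mul_apply, Complex.im_sum]
  refine Finset.sum_congr rfl fun k _ => Finset.sum_congr rfl fun l _ => ?_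
  simp [grad, h]
  ring

/-- The derivative of a power is a noncommutative sum without a convenient closed form. Only its
trace against matrices that commute with `B` is needed, where cyclicity collapses the sum. Admitting
every such `P`, and not just `1`, makes the induction go through. -/
theorem hasDerivAt_pow_line (B V : Matrix (Fin n) (Fin n) ℂ) (m : ℕ) :
    ∃ D : Matrix (Fin n) (Fin n) ℂ,
      HasEntryDeriv (fun s : ℝ => (B + s • V) ^ m) D Set.univ 0 ∧
      ∀ P, Commute P B → (D * P).trace = m * (B ^ (m - 1) * V * P).trace := by
  induction m with
  | zero => exact ⟨0, by simpa using hasEntryDeriv_const 1 _ _, by simp⟩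
  | succ m ih =>
    obtain ⟨D, hD, hT⟩ := ih
    have hline : HasEntryDeriv (fun s : ℝ => B + s • V) V Set.univ 0 := by
      intro i j
      have := ((hasDerivAt_id (0 : ℝ)).smul_const (V i j)).const_add (B i j)
      refine HasDerivAt.hasDerivWithinAt ?_
      simpa using this
    refine ⟨_, by simpa only [pow_succ] using hD.mul hline, fun P hP => ?_⟩
    simp only [zero_smul, add_zero]
    have h1 : (D * (B * P)).trace = m * (B ^ (m - 1) * V * (B * P)).trace :=
      hT (B * P) ((Commute.refl B).mul_left hP)
    rw [add_mul, Matrix.trace_add, mul_assoc, h1]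
    -- The exponent `m - 1` is truncated subtraction; at `m = 0` the factor `m` makes it irrelevant.
    rcases m with _ | m
    · simp
    · have h2 : (B ^ m * V * (B * P)).trace = (B ^ (m + 1) * V * P).trace := by
        rw [Matrix.trace_mul_comm, Matrix.trace_mul_comm (B ^ (m + 1) * V), ← hP.eq, pow_succ']
        simp only [mul_assoc]
      simp only [Nat.add_sub_cancel, h2]
      push_cast
      ring

theorem lineDeriv_hamiltonian (f : Polynomial ℂ) (B V : Matrix (Fin n) (Fin n) ℂ) :
    lineDeriv ℝ (hamiltonian f) B V = pairing (Polynomial.aeval B f.derivative) V := by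
  have h : ∀ f : Polynomial ℂ, HasDerivAt (fun s : ℝ => (Polynomial.aeval (B + s • V) f).trace)
      (Polynomial.aeval B f.derivative * V).trace 0 := by
    intro f
    induction f using Polynomial.induction_on' with
    | add p q hp hq => simpa [add_mul] using hp.fun_add hq
    | monomial m c =>
      obtain ⟨D, hD, hT⟩ := hasDerivAt_pow_line B V m
      have h1 := (hD.trace_mul 1).hasDerivAt Filter.univ_mem
      rw [hT 1 (Commute.one_left B)] at h1
      simp only [mul_one] at h1
      have h2 := h1.const_mul c
      simp only [Polynomial.aeval_monomial, Polynomial.derivative_monomial,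
        ← Algebra.smul_def, Matrix.trace_smul, smul_eq_mul, smul_mul_assoc]
      rwa [mul_assoc]
  have h1 : HasDerivAt (fun s : ℝ => hamiltonian f (B + s • V))
      (pairing (Polynomial.aeval B f.derivative) V) 0 := by
    have := (Complex.imCLM.hasFDerivAt.comp_hasDerivAt (0 : ℝ) (h f))
    exact this
  exact h1.deriv

theorem grad_hamiltonian (f : Polynomial ℂ) (B : Matrix (Fin n) (Fin n) ℂ) :
    grad (hamiltonian f) B = Polynomial.aeval B f.derivative := by
  ext k l
  simp only [grad, Matrix.of_apply, lineDeriv_hamiltonian, pairing, Matrix.trace_mul_single]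
  apply Complex.ext <;> simp

/-- The polynomial `z f'(z)`. -/
def eulerPoly (f : Polynomial ℂ) : Polynomial ℂ := Polynomial.X * f.derivative

theorem aeval_eulerPoly (f : Polynomial ℂ) (B : Matrix (Fin n) (Fin n) ℂ) :
    Polynomial.aeval B (eulerPoly f) = B * Polynomial.aeval B f.derivative := by
  simp [eulerPoly]

theorem commute_aeval (p : Polynomial ℂ) (B : Matrix (Fin n) (Fin n) ℂ) :
    Commute B (Polynomial.aeval B p) := by
  have h : Polynomial.aeval B (Polynomial.X * p) = Polynomial.aeval B (p * Polynomial.X) := by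
    rw [mul_comm]
  simpa [commute_iff_eq] using h

/-- The gradient of the Hamiltonian commutes with `B`, so both arguments of `R` equal `G = B f'(B)`.
Writing `R G = 2 projL G - G`, the term `-G` drops out because it commutes with `B`, and a
commutator with `projL G` remains. -/
theorem bracket_linear (f : Polynomial ℂ) (ψ : Matrix (Fin n) (Fin n) ℂ →ₗ[ℝ] ℝ)
    (B : Matrix (Fin n) (Fin n) ℂ) :
    bracket (hamiltonian f) ψ B = ψ (B * projL (Polynomial.aeval B (eulerPoly f))
      - projL (Polynomial.aeval B (eulerPoly f)) * B) := by
  set G := Polynomial.aeval B (eulerPoly f) with hG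
  have hBG : B * G = G * B := (commute_aeval _ B).eq
  have h1 : Polynomial.aeval B f.derivative * B = G := by
    rw [hG, aeval_eulerPoly, (commute_aeval _ B).eq]
  have h2 : B * Polynomial.aeval B f.derivative = G := by rw [hG, aeval_eulerPoly]
  have hR : rMatrix G = projL G + projL G - G := by
    simp only [rMatrix, projL]
    abel
  have h3 : pairing (grad ψ B) (B * projL G - projL G * B)
      = (1 / 2) * pairing (rMatrix G) (grad ψ B * B)
        - (1 / 2) * pairing (rMatrix G) (B * grad ψ B) := by
    set Y := grad ψ B
    have h4 : pairing (rMatrix G) (Y * B) = pairing Y (B * rMatrix G) := by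
      rw [pairing, pairing, Matrix.trace_mul_comm, mul_assoc]
    have h5 : pairing (rMatrix G) (B * Y) = pairing Y (rMatrix G * B) := by
      rw [pairing, pairing, ← mul_assoc, Matrix.trace_mul_comm]
    rw [h4, h5, hR]
    simp only [pairing, mul_sub, mul_add, sub_mul, add_mul, Matrix.trace_sub, Matrix.trace_add,
      Complex.sub_im, Complex.add_im, hBG]
    ring
  rw [bracket, grad_hamiltonian, h1, h2, ← h3, pairing_grad_linear]

section
attribute [local instance] Matrix.normedAddCommGroup Matrix.normedSpace

theorem contDiff_linear (ψ : Matrix (Fin n) (Fin n) ℂ →ₗ[ℝ] ℝ) : ContDiff ℝ ∞ ψ :=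
  (LinearMap.toContinuousLinearMap ψ).contDiff

end

/-- The Lax equation, from the test functions that are real and imaginary parts of single entries.
-/
theorem IsTrajectory.hasEntryDeriv {f : Polynomial ℂ} {C : ℝ → Matrix (Fin n) (Fin n) ℂ}
    (hC : IsTrajectory (hamiltonian f) C) {t : ℝ} (ht : 0 ≤ t) :
    HasEntryDeriv C (C t * projL (Polynomial.aeval (C t) (eulerPoly f))
      - projL (Polynomial.aeval (C t) (eulerPoly f)) * C t) (Set.Ici 0) t := by
  intro i j
  let re : Matrix (Fin n) (Fin n) ℂ →ₗ[ℝ] ℝ :=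
    { toFun := fun M => (M i j).re, map_add' := by simp, map_smul' := by simp }
  let im : Matrix (Fin n) (Fin n) ℂ →ₗ[ℝ] ℝ :=
    { toFun := fun M => (M i j).im, map_add' := by simp, map_smul' := by simp }
  have h1 := hC re (contDiff_linear re) t ht
  have h2 := hC im (contDiff_linear im) t ht
  rw [bracket_linear] at h1 h2
  have h3 := h1.ofReal_comp.add (h2.ofReal_comp.mul_const Complex.I)
  refine (h3.congr_deriv ?_).congr (fun u _ => ?_) ?_
  · exact Complex.re_add_im _
  · exact (Complex.re_add_im _).symm
  · exact (Complex.re_add_im _).symm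

end lax

/-! ### Lower triangular linear differential equations -/

section ode

theorem hasDerivAt_exp_integral {a : ℝ → ℂ} (ha : Continuous a) (t : ℝ) :
    HasDerivAt (fun t => Complex.exp (∫ u in (0 : ℝ)..t, a u))
      (Complex.exp (∫ u in (0 : ℝ)..t, a u) * a t) t :=
  (ha.integral_hasStrictDerivAt 0 t).hasDerivAt.cexp

/-- The linear equation `y' = -a y - S`. -/
theorem exists_solution_scalar {a S : ℝ → ℂ} (ha : Continuous a) (hS : Continuous S) (c : ℂ) :
    ∃ y : ℝ → ℂ, y 0 = c ∧ (∀ t, HasDerivAt y (-(a t * y t) - S t) t) ∧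
      ((∀ t, S t = 0) → ∀ t, y t = Complex.exp (-∫ u in (0 : ℝ)..t, a u) * c) := by
  let e : ℝ → ℂ := fun t => Complex.exp (∫ u in (0 : ℝ)..t, a u)
  have he : ∀ t, HasDerivAt e (e t * a t) t := hasDerivAt_exp_integral ha
  have hec : Continuous e := continuous_iff_continuousAt.2 fun t => (he t).continuousAt
  have hei : ∀ t, HasDerivAt (fun t => Complex.exp (-∫ u in (0 : ℝ)..t, a u))
      (Complex.exp (-∫ u in (0 : ℝ)..t, a u) * (-a t)) t := fun t =>
    (ha.integral_hasStrictDerivAt 0 t).hasDerivAt.neg.cexp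
  have hI : ∀ t, HasDerivAt (fun t => ∫ u in (0 : ℝ)..t, e u * S u) (e t * S t) t := fun t =>
    ((hec.mul hS).integral_hasStrictDerivAt 0 t).hasDerivAt
  refine ⟨fun t => Complex.exp (-∫ u in (0 : ℝ)..t, a u) * (c - ∫ u in (0 : ℝ)..t, e u * S u),
    by simp, fun t => ?_, fun h t => by simp [h]⟩
  refine ((hei t).mul ((hI t).const_sub c)).congr_deriv ?_
  have h1 : Complex.exp (-∫ u in (0 : ℝ)..t, a u) * e t = 1 := by
    rw [← Complex.exp_add, neg_add_cancel, Complex.exp_zero]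
  linear_combination (-S t) * h1

theorem eq_zero_of_hasDerivWithinAt {a y : ℝ → ℂ} (ha : Continuous a) (h0 : y 0 = 0)
    (hy : ∀ t, 0 ≤ t → HasDerivWithinAt y (-(a t * y t)) (Set.Ici 0) t) {t : ℝ} (ht : 0 ≤ t) :
    y t = 0 := by
  have h := eq_of_hasDerivWithinAt_zero
    (y := fun t => Complex.exp (∫ u in (0 : ℝ)..t, a u) * y t) (fun t ht =>
      (((hasDerivAt_exp_integral ha t).hasDerivWithinAt).mul (hy t ht)).congr_deriv (by ring)) ht
  simpa [h0] using h

variable {n : ℕ} {L : ℝ → Matrix (Fin n) (Fin n) ℂ}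

/-- The equation `X' = -L X` with a lower triangular `L` and `X(0) = 0` has only the zero
solution. -/
theorem eq_zero_of_hasEntryDeriv_lower (hL : ∀ i j, Continuous fun t => L t i j)
    (hlow : ∀ t i j, i < j → L t i j = 0) {X : ℝ → Matrix (Fin n) (Fin n) ℂ} (h0 : X 0 = 0)
    (hX : ∀ t, 0 ≤ t → HasEntryDeriv X (-(L t * X t)) (Set.Ici 0) t) {t : ℝ} (ht : 0 ≤ t) :
    X t = 0 := by
  -- Row `i` of the equation involves only rows up to `i`. Once the earlier rows vanish, it is a
  -- homogeneous scalar equation for each entry.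
  have key : ∀ m : ℕ, ∀ i : Fin n, i.val = m → ∀ j t, 0 ≤ t → X t i j = 0 := by
    intro m
    induction m using Nat.strong_induction_on with
    | _ m ih =>
      intro i hi j t ht
      refine eq_zero_of_hasDerivWithinAt (y := fun u => X u i j) (hL i i) (by simp [h0])
        (fun u hu => (hX u hu i j).congr_deriv ?_) ht
      rw [Matrix.neg_apply, Matrix.mul_apply, Finset.sum_eq_single i]
      · intro k _ hk
        rcases lt_or_gt_of_ne hk with h | h
        · rw [ih k.val (by rw [← hi]; exact h) k rfl j u hu, mul_zero]
        · rw [hlow u i k h, zero_mul]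
      · simp
  ext i j
  exact key i.val i rfl j t ht

open scoped ComplexOrder in
/-- The equation `W' = -L W`, `W(0) = 1`, with a lower triangular `L` whose diagonal is real, has
a lower triangular solution with positive diagonal. -/
theorem exists_lower_solution (hL : ∀ i j, Continuous fun t => L t i j)
    (hlow : ∀ t i j, i < j → L t i j = 0) (hdiag : ∀ t i, (L t i i).im = 0) :
    ∃ W : ℝ → Matrix (Fin n) (Fin n) ℂ, W 0 = 1 ∧
      (∀ t i j, HasDerivAt (fun u => W u i j) ((-(L t * W t)) i j) t) ∧
      (∀ t i j, i < j → W t i j = 0) ∧ ∀ t i, 0 < W t i i := by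
  -- The solution is built row by row: the earlier rows enter the equation of row `m` as the known
  -- source `S`. The source vanishes on and to the right of the diagonal, so the explicit
  -- homogeneous solution there gives the zeros and the positive exponential on the diagonal.
  have key : ∀ m : ℕ, ∃ w : Fin n → Fin n → ℝ → ℂ, ∀ i : Fin n, i.val < m →
      (∀ j, w i j 0 = (1 : Matrix (Fin n) (Fin n) ℂ) i j) ∧
      (∀ j t, HasDerivAt (w i j) (-∑ k, L t i k * w k j t) t) ∧
      (∀ j t, i < j → w i j t = 0) ∧ ∀ t, 0 < w i i t := by
    intro m
    induction m with
    | zero => exact ⟨fun _ _ _ => 0, by simp⟩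
    | succ m ih =>
      obtain ⟨w, hw⟩ := ih
      by_cases hm : m < n
      swap
      · exact ⟨w, fun i _ => hw i (by omega)⟩
      let r : Fin n := ⟨m, hm⟩
      have hlt : ∀ k : Fin n, k < r → k.val < m := fun k hk => hk
      let S : Fin n → ℝ → ℂ := fun j t => ∑ k ∈ Finset.Iio r, L t r k * w k j t
      have hS : ∀ j, Continuous (S j) := fun j =>
        continuous_finsetSum _ fun k hk => (hL r k).mul <|
          continuous_iff_continuousAt.2 fun t =>
            ((hw k (hlt k (Finset.mem_Iio.1 hk))).2.1 j t).continuousAt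
      have hS0 : ∀ j, r ≤ j → ∀ t, S j t = 0 := fun j hj t =>
        Finset.sum_eq_zero fun k hk => by
          have hk' := Finset.mem_Iio.1 hk
          rw [(hw k (hlt k hk')).2.2.1 j t (lt_of_lt_of_le hk' hj), mul_zero]
      choose y hy0 hyd hyS using fun j =>
        exists_solution_scalar (hL r r) (hS j) ((1 : Matrix (Fin n) (Fin n) ℂ) r j)
      have hne : ∀ k : Fin n, k.val < m → k ≠ r := by
        rintro k hk rfl
        exact lt_irrefl _ hk
      have hsum : ∀ (i : Fin n), i ≤ r → ∀ j t,
          ∑ k, L t i k * Function.update w r y k j t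
            = L t i i * Function.update w r y i j t
              + ∑ k ∈ Finset.Iio i, L t i k * w k j t := by
        intro i hi j t
        rw [← Finset.sum_subset (Finset.subset_univ (Finset.Iic i)), ← Finset.Iio_insert,
          Finset.sum_insert (by simp)]
        · congr 1
          refine Finset.sum_congr rfl fun k hk => ?_
          rw [Function.update_of_ne (ne_of_lt (lt_of_lt_of_le (Finset.mem_Iio.1 hk) hi))]
        · intro k _ hk
          rw [hlow t i k (by simpa using hk), zero_mul]
      refine ⟨Function.update w r y, fun i hi => ?_⟩
      rcases Nat.lt_succ_iff_lt_or_eq.1 hi with him | him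
      · have hir : i ≤ r := him.le
        have hs : ∀ j t, ∑ k, L t i k * w k j t
            = L t i i * w i j t + ∑ k ∈ Finset.Iio i, L t i k * w k j t := by
          intro j t
          rw [← Finset.sum_subset (Finset.subset_univ (Finset.Iic i)), ← Finset.Iio_insert,
            Finset.sum_insert (by simp)]
          intro k _ hk
          rw [hlow t i k (by simpa using hk), zero_mul]
        simp only [hsum i hir, Function.update_of_ne (hne i him)]
        simp only [← hs]
        exact hw i him
      · obtain rfl : i = r := Fin.ext him
        simp only [hsum r le_rfl, Function.update_self]
        refine ⟨hy0, fun j t => (hyd j t).congr_deriv (by simp only [S]; ring),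
          fun j t hj => ?_, fun t => ?_⟩
        · rw [hyS j (hS0 j hj.le), Matrix.one_apply_ne hj.ne, mul_zero]
        · rw [hyS r (hS0 r le_rfl), Matrix.one_apply_eq, mul_one]
          have hI : ∫ u in (0 : ℝ)..t, L u r r = ((∫ u in (0 : ℝ)..t, (L u r r).re : ℝ) : ℂ) := by
            rw [← intervalIntegral.integral_ofReal]
            exact intervalIntegral.integral_congr fun u _ => Complex.ext rfl (by simp [hdiag])
          rw [hI, ← Complex.ofReal_neg, ← Complex.ofReal_exp]
          exact_mod_cast Real.exp_pos _
  obtain ⟨w, hw⟩ := key n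
  refine ⟨fun t => Matrix.of fun i j => w i j t, ?_, fun t i j => ?_, fun t i j hij => ?_,
    fun t i => ?_⟩
  · ext i j
    exact (hw i i.isLt).1 j
  · refine ((hw i i.isLt).2.1 j t).congr_deriv ?_
    simp [Matrix.mul_apply]
  · exact (hw i i.isLt).2.2.1 j t hij
  · exact (hw i i.isLt).2.2.2 t

end ode

/-! ### The flow in terms of a triangular factorization -/

section flow
variable {n : ℕ}

theorem aeval_mul_of_mul_eq {A B X : Matrix (Fin n) (Fin n) ℂ} (h : A * X = X * B)
    (p : Polynomial ℂ) : Polynomial.aeval A p * X = X * Polynomial.aeval B p := by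
  induction p using Polynomial.induction_on' with
  | add p q hp hq => rw [map_add, map_add, add_mul, mul_add, hp, hq]
  | monomial m c =>
    have hm : A ^ m * X = X * B ^ m := by
      induction m with
      | zero => simp
      | succ m ih => rw [pow_succ, mul_assoc, h, ← mul_assoc, ih, mul_assoc, pow_succ]
    simp only [Polynomial.aeval_monomial, ← Algebra.smul_def, smul_mul_assoc, mul_smul_comm, hm]

theorem aeval_diagonal (z : Fin n → ℂ) (p : Polynomial ℂ) :
    Polynomial.aeval (Matrix.diagonal z) p = Matrix.diagonal fun i => p.eval (z i) := by
  have := Polynomial.aeval_algHom_apply (Matrix.diagonalAlgHom (n := Fin n) (α := ℂ) ℂ) z p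
  rw [Matrix.diagonalAlgHom_apply] at this
  rw [this, Matrix.diagonalAlgHom_apply]
  congr 1
  ext i
  rw [Polynomial.aeval_pi_apply₂]
  simp

theorem projL_add_projA (X : Matrix (Fin n) (Fin n) ℂ) : projL X + projA X = X := by
  simp [projL]

theorem continuous_projL_entry {X : ℝ → Matrix (Fin n) (Fin n) ℂ} (hX : Continuous X)
    (i j : Fin n) : Continuous fun t => projL (X t) i j := by
  have h : ∀ i j, Continuous fun t => X t i j := fun i j => hX.matrix_elem i j
  simp only [projL, projA, Matrix.sub_apply, Matrix.of_apply]
  split_ifs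
  · exact (h i j).sub (h i j)
  · exact (h i j).sub (h j i).star.neg
  · exact (h i j).sub (continuous_const.mul (Complex.continuous_ofReal.comp
      (Complex.continuous_im.comp (h i i))))

/-- The diagonal matrix `exp(t p(z_j))`. -/
def expDiag (p : Polynomial ℂ) (z : Fin n → ℂ) (t : ℝ) : Matrix (Fin n) (Fin n) ℂ :=
  Matrix.diagonal fun i => Complex.exp (t * p.eval (z i))

theorem hasEntryDeriv_expDiag (p : Polynomial ℂ) (z : Fin n → ℂ) (s : Set ℝ) (t : ℝ) :
    HasEntryDeriv (expDiag p z) ((Matrix.diagonal fun i => p.eval (z i)) * expDiag p z t) s t := by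
  intro i j
  by_cases hij : i = j
  · subst hij
    have h := ((hasDerivAt_id (t : ℂ)).mul_const (p.eval (z i))).cexp.comp_ofReal
    simp only [expDiag, Matrix.diagonal_mul_diagonal, Matrix.diagonal_apply_eq]
    refine h.hasDerivWithinAt.congr_deriv ?_
    simp [mul_comm]
  · simp only [expDiag, Matrix.diagonal_mul_diagonal, Matrix.diagonal_apply_ne _ hij]
    exact hasDerivWithinAt_const _ _ _

open scoped ComplexOrder in
/-- Along a trajectory from a unitary matrix `C(0) = Q diag(z) Qᴴ` there is a lower triangular
`W(t)` with positive diagonal which intertwines `C(0)` and `C(t)`, and for which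
`W(t) Q exp(t g(z)) Qᴴ` is unitary. -/
theorem exists_lower_intertwining {f : Polynomial ℂ} {C : ℝ → Matrix (Fin n) (Fin n) ℂ}
    (hC : IsTrajectory (hamiltonian f) C) {Q : Matrix (Fin n) (Fin n) ℂ} {z : Fin n → ℂ}
    (hQ : Qᴴ * Q = 1) (hCQ : C 0 * Q = Q * Matrix.diagonal z) {t : ℝ} (ht : 0 ≤ t) :
    ∃ W : Matrix (Fin n) (Fin n) ℂ, (∀ i j, i < j → W i j = 0) ∧ (∀ i, 0 < W i i) ∧
      C t * W = W * C 0 ∧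
      (W * Q * expDiag (eulerPoly f) z t)ᴴ * (W * Q * expDiag (eulerPoly f) z t) = 1 := by
  set g := eulerPoly f with hg
  have hQ' : Q * Qᴴ = 1 := mul_eq_one_comm.1 hQ
  -- The trajectory is controlled for `t ≥ 0` only; freezing it at `C 0` for negative times gives
  -- coefficients that are continuous on the whole line.
  have hcont : Continuous fun t => C (max t 0) := by
    refine continuous_matrix fun i j => ?_
    have h1 : ContinuousOn (fun t => C t i j) (Set.Ici 0) := fun t ht =>
      ((hC.hasEntryDeriv ht) i j).continuousWithinAt
    exact h1.comp_continuous (continuous_id.max continuous_const) fun t =>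
      Set.mem_Ici.2 (le_max_right _ _)
  let L : ℝ → Matrix (Fin n) (Fin n) ℂ := fun t => projL (Polynomial.aeval (C (max t 0)) g)
  have hLc : ∀ i j, Continuous fun t => L t i j :=
    continuous_projL_entry ((Polynomial.continuous_aeval g).comp hcont)
  have hLt : ∀ t, 0 ≤ t → L t = projL (Polynomial.aeval (C t) g) := fun t ht => by
    simp only [L, max_eq_left ht]
  obtain ⟨W, hW0, hWd, hWlow, hWpos⟩ := exists_lower_solution hLc
    (fun t i j hij => projL_upper _ hij) (fun t i => projL_diag _ i)
  have hW : ∀ t, HasEntryDeriv W (-(L t * W t)) (Set.Ici 0) t := fun t i j =>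
    (hWd t i j).hasDerivWithinAt
  have hCd : ∀ t, 0 ≤ t → HasEntryDeriv C (C t * L t - L t * C t) (Set.Ici 0) t := fun t ht => by
    rw [hLt t ht]
    exact hC.hasEntryDeriv ht
  -- The difference of the two sides starts at zero and satisfies `D' = -L D`.
  have hCW : ∀ t, 0 ≤ t → C t * W t = W t * C 0 := by
    intro t ht
    refine sub_eq_zero.1 (eq_zero_of_hasEntryDeriv_lower hLc (fun t i j hij => projL_upper _ hij)
      (X := fun u => C u * W u - W u * C 0) (by simp [hW0]) (fun u hu => ?_) ht)
    have := ((hCd u hu).mul (hW u)).sub ((hW u).mul (hasEntryDeriv_const (C 0) _ _))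
    convert this using 1
    noncomm_ring
  -- The exponential contributes `g(C) U` to the derivative and `W` contributes `-L U`; together
  -- they leave the anti-Hermitian part of `g(C)`, so `Uᴴ U` is conserved.
  let U : ℝ → Matrix (Fin n) (Fin n) ℂ := fun t => W t * (Q * expDiag g z t)
  have hU : ∀ t, 0 ≤ t → HasEntryDeriv U (projA (Polynomial.aeval (C t) g) * U t) (Set.Ici 0) t := by
    intro t ht
    have h1 := (hW t).mul ((hasEntryDeriv_const Q _ _).mul
      (hasEntryDeriv_expDiag g z (Set.Ici 0) t))
    convert h1 using 1
    have h2 : Polynomial.aeval (C t) g * W t = W t * Polynomial.aeval (C 0) g :=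
      aeval_mul_of_mul_eq (hCW t ht) g
    have h3 : Polynomial.aeval (C 0) g * Q = Q * Matrix.diagonal fun i => g.eval (z i) := by
      rw [aeval_mul_of_mul_eq hCQ, aeval_diagonal]
    have h4 : projA (Polynomial.aeval (C t) g) = Polynomial.aeval (C t) g - L t := by
      rw [hLt t ht, eq_sub_iff_add_eq', projL_add_projA]
    have h5 : W t * (Q * ((Matrix.diagonal fun i => g.eval (z i)) * expDiag g z t))
        = Polynomial.aeval (C t) g * U t := by
      rw [← mul_assoc Q, ← h3]
      simp only [U]
      rw [← mul_assoc (Polynomial.aeval (C t) g), h2]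
      simp only [mul_assoc]
    rw [h4, zero_mul, zero_add, h5, sub_mul]
    simp only [U]
    noncomm_ring
  have hUU : (U t)ᴴ * U t = (U 0)ᴴ * U 0 := by
    refine eq_of_hasEntryDeriv_zero (X := fun u => (U u)ᴴ * U u) (fun u hu => ?_) ht
    have := (hU u hu).conjTranspose.mul (hU u hu)
    convert this using 1
    rw [Matrix.conjTranspose_mul, projA_conjTranspose]
    noncomm_ring
  have hU0 : U 0 = Q := by
    have : expDiag g z 0 = 1 := by simp [expDiag]
    simp only [U, hW0, this, one_mul, mul_one]
  refine ⟨W t, hWlow t, hWpos t, hCW t ht, ?_⟩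
  rw [mul_assoc]
  change (U t)ᴴ * U t = 1
  rw [hUU, hU0, hQ]

theorem mul_diagonal_conjTranspose_of_mul_eq {A X : Matrix (Fin n) (Fin n) ℂ} {z : Fin n → ℂ}
    (hX : Xᴴ * X = 1) (h : A * X = X * Matrix.diagonal z) :
    A = X * Matrix.diagonal z * Xᴴ := by
  have hX' : X * Xᴴ = 1 := mul_eq_one_comm.1 hX
  rw [← h, mul_assoc, hX', mul_one]

open scoped ComplexOrder in
theorem IsShape.map_star {p : ℕ} {B : Matrix (Fin n) (Fin n) ℂ} (h : IsShape p B) :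
    IsShape p (B.map star) := by
  refine ⟨fun i j hij => ?_, fun i j hij hi => ?_, fun i j hij hi => ?_, fun hp i j hi hj => ?_⟩
  · simp [h.far i j hij]
  · simp [h.near i j hij hi]
  · exact star_pos_iff.2 (h.pos i j hij hi)
  · exact star_pos_iff.2 (h.first hp i j hi hj)

theorem cmv_conjTranspose_isShape {α : Fin n → ℂ} (hα : IsVerblunsky α) : IsShape 1 (cmv α)ᴴ :=
  (cmv_transpose_isShape hα).map_star

open scoped ComplexOrder in
/-- A trajectory that starts at a CMV matrix consists of CMV matrices. -/
theorem exists_cmv_of_intertwining {α₀ : Fin n → ℂ} (hα₀ : IsVerblunsky α₀)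
    {B W X : Matrix (Fin n) (Fin n) ℂ} {z : Fin n → ℂ} (hn : n ≠ 0)
    (hW : ∀ i j, i < j → W i j = 0) (hd : ∀ i, 0 < W i i) (hBW : B * W = W * cmv α₀)
    (hX : Xᴴ * X = 1) (hBX : B * X = X * Matrix.diagonal z) (hz : ∀ i, conj (z i) * z i = 1) :
    ∃ α : Fin n → ℂ, IsVerblunsky α ∧ B = cmv α := by
  obtain ⟨m, rfl⟩ := Nat.exists_eq_succ_of_ne_zero hn
  have hX' : X * Xᴴ = 1 := mul_eq_one_comm.1 hX
  have hB : Bᴴ * B = 1 := by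
    have hD : (Matrix.diagonal z)ᴴ * Matrix.diagonal z = 1 := by
      rw [Matrix.diagonal_conjTranspose, Matrix.diagonal_mul_diagonal, ← Matrix.diagonal_one]
      congr 1
      ext i
      exact hz i
    rw [mul_diagonal_conjTranspose_of_mul_eq hX hBX]
    simp only [Matrix.conjTranspose_mul, Matrix.conjTranspose_conjTranspose]
    calc X * ((Matrix.diagonal z)ᴴ * Xᴴ) * (X * Matrix.diagonal z * Xᴴ)
        = X * ((Matrix.diagonal z)ᴴ * (Xᴴ * X) * Matrix.diagonal z) * Xᴴ := by
          simp only [mul_assoc]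
      _ = 1 := by rw [hX, mul_one, hD, mul_one, hX']
  have hU := conjTranspose_mul_cmv hα₀
  have hB' : B * Bᴴ = 1 := mul_eq_one_comm.1 hB
  have hU' : cmv α₀ * (cmv α₀)ᴴ = 1 := mul_eq_one_comm.1 hU
  -- Both matrices are unitary, so the same lower triangular `W` intertwines their inverses. This
  -- controls the lower half of the shape without passing to an upper triangular matrix.
  have hBW' : Bᴴ * W = W * (cmv α₀)ᴴ := by
    calc Bᴴ * W = Bᴴ * (W * cmv α₀) * (cmv α₀)ᴴ := by
          rw [mul_assoc, mul_assoc, hU', mul_one]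
      _ = W * (cmv α₀)ᴴ := by rw [← hBW, ← mul_assoc, hB, one_mul]
  refine exists_eq_cmv hB ((cmv_isShape hα₀).conj_lower hW hd hBW) ?_
  have h1 : IsShape 1 Bᴴ := (cmv_conjTranspose_isShape hα₀).conj_lower hW hd hBW'
  have h2 : Bᵀ = Bᴴ.map star := by
    ext i j
    simp
  exact h2 ▸ h1.map_star

end flow

/-! ### Minors of the eigenvector matrix -/

section minors
variable {n k : ℕ}

/-- For `k` columns `e`, the lower triangular factor multiplies the minor in the first `k` rows by
its own leading minor, which does not depend on `e`. -/
theorem submatrix_castLE_lower_mul (hk : k ≤ n) {S X : Matrix (Fin n) (Fin n) ℂ}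
    (hS : ∀ i j, i < j → S i j = 0) (e : Fin k → Fin n) :
    (S * X).submatrix (Fin.castLE hk) e
      = S.submatrix (Fin.castLE hk) (Fin.castLE hk) * X.submatrix (Fin.castLE hk) e := by
  ext i j
  rw [Matrix.submatrix_apply, Matrix.mul_apply, Matrix.mul_apply]
  symm
  refine Fintype.sum_of_injective (Fin.castLE hk) (Fin.castLE_injective hk) _ _ ?_ fun _ => rfl
  intro m hm
  have hm' : k ≤ m.val := by
    by_contra hlt
    exact hm ⟨⟨m.val, by omega⟩, rfl⟩
  rw [hS _ _ (Fin.lt_def.2 (lt_of_lt_of_le i.isLt hm')), zero_mul]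

theorem vander_map (z : Fin n → ℂ) (e : Fin k ↪o Fin n) :
    vander z (Finset.univ.map e.toEmbedding) = (Matrix.vandermonde fun i => z (e i)).det := by
  rw [Matrix.det_vandermonde, vander, Finset.prod_filter, Finset.prod_product, Finset.prod_map]
  refine Finset.prod_congr rfl fun i _ => ?_
  rw [Finset.prod_map, ← Finset.filter_lt_eq_Ioi, Finset.prod_filter]
  refine Finset.prod_congr rfl fun j _ => ?_
  simp

theorem sum_orderEmbedding {M : Type*} [AddCommMonoid M] (H : Finset (Fin n) → M) :
    ∑ e : Fin k ↪o Fin n, H (Finset.univ.map e.toEmbedding)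
      = ∑ I ∈ (Finset.univ : Finset (Fin n)).powersetCard k, H I := by
  refine Finset.sum_bij' (fun e _ => Finset.univ.map e.toEmbedding)
    (fun I hI => I.orderEmbOfFin (Finset.mem_powersetCard.1 hI).2) ?_ ?_ ?_ ?_ ?_
  · intro e _
    simp [Finset.mem_powersetCard]
  · simp
  · intro e _
    symm
    apply Finset.orderEmbOfFin_unique'
    simp
  · intro I hI
    ext x
    have := Finset.range_orderEmbOfFin I (Finset.mem_powersetCard.1 hI).2
    rw [← Finset.mem_coe (s := I), ← this]
    simp
  · simp

/-- The functions `1, z̄, z, z̄², z², …` on the unit circle. -/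
def zigzag (p : ℕ) (w : ℂ) : ℂ := if p % 2 = 0 then w ^ (p / 2) else conj w ^ ((p + 1) / 2)

/-- On the unit circle, pulling the unimodular factor `conj (w i) ^ (k / 2)` out of each column
shifts the exponents `0, -1, 1, -2, 2, …` to a rearrangement of `0, …, k - 1`, namely `σ`. This
leaves a Vandermonde matrix with permuted rows. -/
theorem norm_det_zigzag {w : Fin k → ℂ} (hw : ∀ i, conj (w i) * w i = 1) :
    ‖(Matrix.of fun p i : Fin k => zigzag p (w i)).det‖ = ‖(Matrix.vandermonde w).det‖ := by
  let σ : Fin k → Fin k := fun p =>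
    ⟨if p.val % 2 = 0 then k / 2 + p.val / 2 else k / 2 - (p.val + 1) / 2, by
      have := p.isLt
      split_ifs <;> omega⟩
  have hσ : Function.Injective σ := by
    intro p q h
    have h' := congrArg Fin.val h
    simp only [σ] at h'
    have := p.isLt
    have := q.isLt
    apply Fin.ext
    split_ifs at h' <;> omega
  let τ : Equiv.Perm (Fin k) := Equiv.ofBijective σ (Finite.injective_iff_bijective.1 hσ)
  have h1 : (Matrix.of fun p i : Fin k => zigzag p (w i))
      = Matrix.of fun p i => conj (w i) ^ (k / 2) * (Matrix.vandermonde w)ᵀ.submatrix τ id p i := by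
    ext p i
    have hc : ∀ m l : ℕ, conj (w i) ^ (m + l) * w i ^ m = conj (w i) ^ l := by
      intro m l
      rw [pow_add, mul_right_comm, ← mul_pow, hw, one_pow, one_mul]
    have hτ : τ p = σ p := rfl
    simp only [Matrix.of_apply, Matrix.submatrix_apply, Matrix.transpose_apply,
      Matrix.vandermonde_apply, id, hτ, σ, zigzag]
    have hp := p.isLt
    split_ifs with h
    · rw [pow_add, ← mul_assoc, ← mul_pow, hw, one_pow, one_mul]
    · rw [← hc (k / 2 - (p.val + 1) / 2)]
      congr 2
      omega
  have hn : ∀ i, ‖w i‖ = 1 := by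
    intro i
    have := congrArg norm (hw i)
    rw [norm_mul, RCLike.norm_conj, norm_one] at this
    nlinarith [norm_nonneg (w i)]
  rw [h1, Matrix.det_mul_row, Matrix.det_permute, Matrix.det_transpose, norm_mul, norm_mul,
    norm_prod, Finset.prod_eq_one (fun i _ => by simp [hn])]
  rcases Int.units_eq_one_or (Equiv.Perm.sign τ) with h | h <;> simp [h]

-- One multiplication by `B` moves the last nonzero position of a row vector from `c` to exactly `c
-- + 2` and keeps it positive, provided that `c` has the parity of the corners.
open scoped ComplexOrder in
theorem IsShape.vecMul {p c : ℕ} {B : Matrix (Fin n) (Fin n) ℂ} (hB : IsShape p B)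
    (hc : c % 2 = p % 2) {x : Fin n → ℂ} (hx : ∀ j, c < j.val → x j = 0)
    (hxc : ∀ j, j.val = c → 0 < x j) :
    (∀ j : Fin n, c + 2 < j.val → (∑ m, x m * B m j) = 0) ∧
      ∀ j : Fin n, j.val = c + 2 → 0 < ∑ m, x m * B m j := by
  refine ⟨fun j hj => Finset.sum_eq_zero fun m _ => ?_, fun j hj => ?_⟩
  · rcases lt_or_ge c m.val with h | h
    · rw [hx m h, zero_mul]
    · rw [hB.far m j (by omega), mul_zero]
  · rw [Finset.sum_eq_single (⟨c, by omega⟩ : Fin n)]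
    · exact mul_pos (hxc _ rfl) (hB.pos _ _ hj hc)
    · intro m _ hm
      have hm' : m.val ≠ c := fun h => hm (Fin.ext h)
      rcases lt_or_ge c m.val with h | h
      · rw [hx m h, zero_mul]
      · rw [hB.far m j (by omega), mul_zero]
    · simp

open scoped ComplexOrder in
theorem IsShape.pow_row_zero [NeZero n] {B : Matrix (Fin n) (Fin n) ℂ} (hB : IsShape 0 B) (m : ℕ) :
    (∀ j : Fin n, 2 * m < j.val → (B ^ m) 0 j = 0) ∧
      ∀ j : Fin n, j.val = 2 * m → 0 < (B ^ m) 0 j := by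
  induction m with
  | zero =>
    refine ⟨fun j hj => ?_, fun j hj => ?_⟩
    · rw [pow_zero, Matrix.one_apply_ne]
      rintro rfl
      simp at hj
    · obtain rfl : j = 0 := Fin.ext (by simpa using hj)
      simp
  | succ m ih =>
    simp only [pow_succ, Matrix.mul_apply]
    exact hB.vecMul (c := 2 * m) (by omega) ih.1 ih.2

open scoped ComplexOrder in
theorem IsShape.pow_succ_row_zero [NeZero n] {B : Matrix (Fin n) (Fin n) ℂ} (hB : IsShape 1 B)
    (m : ℕ) : (∀ j : Fin n, 2 * m + 1 < j.val → (B ^ (m + 1)) 0 j = 0) ∧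
      ∀ j : Fin n, j.val = 2 * m + 1 → 0 < (B ^ (m + 1)) 0 j := by
  induction m with
  | zero =>
    simp only [zero_add, pow_one, mul_zero]
    refine ⟨fun j hj => ?_, fun j hj => hB.first rfl 0 j (by simp) hj⟩
    rcases Nat.lt_or_ge 2 j.val with h | h
    · exact hB.far 0 j (by simpa using h)
    · exact hB.near 0 j (by simp; omega) (by simp)
  | succ m ih =>
    rw [pow_succ]
    simp only [Matrix.mul_apply]
    exact hB.vecMul (c := 2 * m + 1) (by omega) ih.1 ih.2

variable {Q : Matrix (Fin n) (Fin n) ℂ} {z : Fin n → ℂ}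

theorem conj_mul_self_eigenvalue {C : Matrix (Fin n) (Fin n) ℂ} (hC : Cᴴ * C = 1)
    (hQ : Qᴴ * Q = 1) (hCQ : C * Q = Q * Matrix.diagonal z) (i : Fin n) :
    conj (z i) * z i = 1 := by
  have h : (Matrix.diagonal z)ᴴ * Matrix.diagonal z = 1 := by
    calc (Matrix.diagonal z)ᴴ * Matrix.diagonal z
        = (Q * Matrix.diagonal z)ᴴ * (Q * Matrix.diagonal z) := by
          rw [Matrix.conjTranspose_mul, mul_assoc, ← mul_assoc Qᴴ, hQ, one_mul]
      _ = 1 := by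
          rw [← hCQ, Matrix.conjTranspose_mul, mul_assoc, ← mul_assoc Cᴴ, hC, one_mul, hQ]
  have := congrFun (congrFun h i) i
  rwa [Matrix.diagonal_conjTranspose, Matrix.diagonal_mul_diagonal, Matrix.diagonal_apply_eq,
    Matrix.one_apply_eq] at this

theorem conjTranspose_mul_eigenvectors {C : Matrix (Fin n) (Fin n) ℂ} (hC : Cᴴ * C = 1)
    (hQ : Qᴴ * Q = 1) (hCQ : C * Q = Q * Matrix.diagonal z) :
    Cᴴ * Q = Q * Matrix.diagonal fun i => conj (z i) := by
  have hz := conj_mul_self_eigenvalue hC hQ hCQ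
  have hD : Matrix.diagonal z * Matrix.diagonal (fun i => conj (z i)) = 1 := by
    rw [Matrix.diagonal_mul_diagonal, ← Matrix.diagonal_one]
    congr 1
    ext i
    rw [mul_comm, hz]
  calc Cᴴ * Q = Cᴴ * (Q * Matrix.diagonal z) * Matrix.diagonal (fun i => conj (z i)) := by
        rw [mul_assoc, mul_assoc, hD, mul_one]
    _ = _ := by rw [← hCQ, ← mul_assoc, hC, one_mul]

variable [NeZero n]

open scoped ComplexOrder in
/-- The vectors `z_i^{e_p} Q_{0,i}` are obtained from the rows of the eigenvector matrix by a
lower triangular matrix with positive diagonal. -/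
theorem exists_lower_mul_eq_zigzag {C : Matrix (Fin n) (Fin n) ℂ} (h0 : IsShape 0 C)
    (h1 : IsShape 1 Cᴴ) (hC : Cᴴ * C = 1) (hQ : Qᴴ * Q = 1)
    (hCQ : C * Q = Q * Matrix.diagonal z) :
    ∃ S : Matrix (Fin n) (Fin n) ℂ, (∀ i j, i < j → S i j = 0) ∧ (∀ i, 0 < S i i) ∧
      S * Q = Matrix.of fun p i : Fin n => Q 0 i * zigzag p (z i) := by
  have hpow : ∀ {A : Matrix (Fin n) (Fin n) ℂ} {d : Fin n → ℂ}, A * Q = Q * Matrix.diagonal d →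
      ∀ m i, ∑ j, (A ^ m) 0 j * Q j i = Q 0 i * d i ^ m := by
    intro A d h m i
    have := aeval_mul_of_mul_eq h (Polynomial.X ^ m)
    simp only [map_pow, Polynomial.aeval_X, Matrix.diagonal_pow] at this
    have h2 := congrFun (congrFun this 0) i
    rwa [Matrix.mul_apply, Matrix.mul_diagonal] at h2
  -- The first rows of `1, Cᴴ, C, (Cᴴ)², C², …` end at the positions `0, 1, 2, 3, 4, …`. Multiplied
  -- by `Q` they become powers of the eigenvalues times the first row of `Q`.
  refine ⟨Matrix.of fun p i => if p.val % 2 = 0 then (C ^ (p.val / 2)) 0 i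
    else (Cᴴ ^ ((p.val - 1) / 2 + 1)) 0 i, fun i j hij => ?_, fun i => ?_, ?_⟩
  · have hij' : i.val < j.val := hij
    simp only [Matrix.of_apply]
    split_ifs with h
    · exact (h0.pow_row_zero _).1 j (by omega)
    · exact (h1.pow_succ_row_zero _).1 j (by omega)
  · simp only [Matrix.of_apply]
    split_ifs with h
    · exact (h0.pow_row_zero _).2 i (by omega)
    · exact (h1.pow_succ_row_zero _).2 i (by omega)
  · ext p i
    simp only [Matrix.mul_apply, Matrix.of_apply, zigzag]
    split_ifs with h
    · exact hpow hCQ _ _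
    · rw [hpow (conjTranspose_mul_eigenvectors hC hQ hCQ)]
      congr 2
      omega

open scoped ComplexOrder in
/-- The minors of the first `k` rows of the eigenvector matrix, up to a common factor. -/
theorem exists_norm_minor_eq {C : Matrix (Fin n) (Fin n) ℂ} (h0 : IsShape 0 C)
    (h1 : IsShape 1 Cᴴ) (hC : Cᴴ * C = 1) (hQ : Qᴴ * Q = 1)
    (hCQ : C * Q = Q * Matrix.diagonal z) (hk : k ≤ n) :
    ∃ c : ℝ, 0 < c ∧ ∀ e : Fin k → Fin n,
      c * ‖(Q.submatrix (Fin.castLE hk) e).det‖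
        = (∏ i, ‖Q 0 (e i)‖) * ‖(Matrix.vandermonde fun i => z (e i)).det‖ := by
  obtain ⟨S, hS, hSd, hSQ⟩ := exists_lower_mul_eq_zigzag h0 h1 hC hQ hCQ
  refine ⟨‖(S.submatrix (Fin.castLE hk) (Fin.castLE hk)).det‖, ?_, fun e => ?_⟩
  · have hlow : (S.submatrix (Fin.castLE hk) (Fin.castLE hk)).IsLowerTriangular := fun i j h =>
      hS _ _ (Fin.strictMono_castLE hk (OrderDual.toDual_lt_toDual.1 h))
    rw [norm_pos_iff, Matrix.det_of_isLowerTriangular _ hlow]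
    exact Finset.prod_ne_zero_iff.2 fun i _ => (hSd _).ne'
  · rw [← norm_mul, ← Matrix.det_mul, ← submatrix_castLE_lower_mul hk hS, hSQ,
      ← norm_det_zigzag (fun i => conj_mul_self_eigenvalue hC hQ hCQ (e i)), ← norm_prod,
      ← norm_mul, ← Matrix.det_mul_row]
    rfl

/-- For `k = n` the minor is `det Q ≠ 0`, so no factor on the other side can vanish: the first basis
vector is cyclic and the spectrum is simple. -/
theorem eigenvector_entry_ne_zero {C : Matrix (Fin n) (Fin n) ℂ} (h0 : IsShape 0 C)
    (h1 : IsShape 1 Cᴴ) (hC : Cᴴ * C = 1) (hQ : Qᴴ * Q = 1)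
    (hCQ : C * Q = Q * Matrix.diagonal z) :
    (∀ i, Q 0 i ≠ 0) ∧ Function.Injective z := by
  obtain ⟨c, hc, h⟩ := exists_norm_minor_eq h0 h1 hC hQ hCQ le_rfl
  have hdet : Q.det ≠ 0 := by
    intro h0
    have := congrArg Matrix.det hQ
    rw [Matrix.det_mul, h0, mul_zero, Matrix.det_one] at this
    exact zero_ne_one this
  have h2 := h id
  have h3 : (∏ i, ‖Q 0 (id i)‖) * ‖(Matrix.vandermonde fun i => z (id i)).det‖ ≠ 0 := by
    rw [← h2]
    exact mul_ne_zero hc.ne' (norm_ne_zero_iff.2 hdet)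
  refine ⟨fun i => ?_, ?_⟩
  · have := Finset.prod_ne_zero_iff.1 (left_ne_zero_of_mul h3) i (Finset.mem_univ i)
    simpa using this
  · exact Matrix.det_vandermonde_ne_zero_iff.1 (norm_ne_zero_iff.1 (right_ne_zero_of_mul h3))

/-- Since the eigenvalues are distinct, the eigenspace is the line spanned by column `j` of `Q`. -/
theorem spectralMass_eq {C : Matrix (Fin n) (Fin n) ℂ} (hQ : Qᴴ * Q = 1)
    (hCQ : C * Q = Q * Matrix.diagonal z) (hz : Function.Injective z) (j : Fin n) :
    spectralMass C (z j) = ‖Q 0 j‖ ^ 2 := by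
  have hQ' : Q * Qᴴ = 1 := mul_eq_one_comm.1 hQ
  let q : EuclideanSpace ℂ (Fin n) := WithLp.toLp 2 fun i => Q i j
  have hq : ‖q‖ = 1 := by
    have := congrFun (congrFun hQ j) j
    rw [Matrix.mul_apply, Matrix.one_apply_eq] at this
    have h2 : (inner ℂ q q : ℂ) = 1 := by
      rw [← this, EuclideanSpace.inner_eq_star_dotProduct]
      simp [q, dotProduct, mul_comm]
    have h3 : ‖q‖ ^ 2 = 1 := by
      rw [← inner_self_eq_norm_sq (𝕜 := ℂ), h2]
      simp
    exact (pow_eq_one_iff_of_nonneg (norm_nonneg _) two_ne_zero).1 h3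
  have heig : Module.End.eigenspace (Matrix.toEuclideanLin C) (z j) = Submodule.span ℂ {q} := by
    ext v
    rw [Module.End.mem_eigenspace_iff, Submodule.mem_span_singleton]
    constructor
    · intro hv
      have hv' : C *ᵥ v.ofLp = z j • v.ofLp := congrArg WithLp.ofLp hv
      let y : Fin n → ℂ := Qᴴ *ᵥ v.ofLp
      have hvy : v.ofLp = Q *ᵥ y := by simp [y, hQ']
      have hy : ∀ i, i ≠ j → y i = 0 := by
        have h1 : Q *ᵥ (Matrix.diagonal z *ᵥ y) = Q *ᵥ (z j • y) := by
          rw [Matrix.mulVec_mulVec, ← hCQ, ← Matrix.mulVec_mulVec, ← hvy, hv',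
            Matrix.mulVec_smul, ← hvy]
        have h2 : Matrix.diagonal z *ᵥ y = z j • y := by
          have := congrArg (fun x => Qᴴ *ᵥ x) h1
          simpa only [Matrix.mulVec_mulVec, ← mul_assoc, hQ, one_mul, Matrix.one_mulVec] using this
        intro i hi
        have h3 := congrFun h2 i
        rw [Matrix.mulVec_diagonal, Pi.smul_apply, smul_eq_mul] at h3
        by_contra hne
        exact hi (hz (mul_right_cancel₀ hne h3))
      refine ⟨y j, ?_⟩
      ext i
      have h4 := congrFun hvy i
      rw [h4]
      simp only [PiLp.smul_apply, q, smul_eq_mul, Matrix.mulVec, dotProduct]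
      rw [Finset.sum_eq_single j (fun m _ hm => by rw [hy m hm, mul_zero]) (by simp), mul_comm]
    · rintro ⟨c, rfl⟩
      rw [map_smul, smul_comm]
      congr 1
      ext i
      have := congrFun (congrFun hCQ i) j
      rw [Matrix.mul_diagonal, mul_comm, Matrix.mul_apply] at this
      simpa [Matrix.toLpLin_apply, q, Matrix.mulVec, dotProduct] using this
  simp only [spectralMass, heig]
  rw [Submodule.starProjection_unit_singleton ℂ hq, norm_smul, hq, mul_one,
    EuclideanSpace.inner_single_right]
  simp [q]

end minors

/-! ### The Verblunsky coefficients along the flow -/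

section coefficients
variable {n k : ℕ}

/-- Cauchy-Binet for `X diag(d)` and `Xᴴ`, whose minors are conjugate up to the factor `∏ d`. The
choice `d = 1` will supply the normalization. -/
theorem det_leading_eq_sum {B X : Matrix (Fin n) (Fin n) ℂ} {d : Fin n → ℂ}
    (h : B = X * Matrix.diagonal d * Xᴴ) (hk : k ≤ n) :
    (B.submatrix (Fin.castLE hk) (Fin.castLE hk)).det
      = ∑ e : Fin k ↪o Fin n,
        ((‖(X.submatrix (Fin.castLE hk) e).det‖ ^ 2 : ℝ) : ℂ) * ∏ i, d (e i) := by
  have h1 : B.submatrix (Fin.castLE hk) (Fin.castLE hk)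
      = (X * Matrix.diagonal d).submatrix (Fin.castLE hk) id * Xᴴ.submatrix id (Fin.castLE hk) := by
    rw [h]
    rfl
  rw [h1, det_mul_eq_sum_orderEmbedding]
  refine Finset.sum_congr rfl fun e _ => ?_
  have h2 : ((X * Matrix.diagonal d).submatrix (Fin.castLE hk) id).submatrix id e
      = Matrix.of fun i j => d (e j) * X.submatrix (Fin.castLE hk) e i j := by
    ext i j
    simp [Matrix.mul_diagonal, mul_comm]
  have h3 : (Xᴴ.submatrix id (Fin.castLE hk)).submatrix e id
      = (X.submatrix (Fin.castLE hk) e)ᴴ := rfl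
  rw [h2, h3, Matrix.det_mul_row, Matrix.det_conjTranspose, mul_assoc, RCLike.star_def,
    Complex.mul_conj, Complex.normSq_eq_norm_sq, mul_comm]

/-- The weight of a multi-index in the limit formulas. -/
def weight (z : Fin n → ℂ) (μ : Fin n → ℝ) (I : Finset (Fin n)) : ℝ :=
  ‖vander z I‖ ^ 2 * multi μ I

theorem norm_exp_sq (t : ℝ) (w : ℂ) : ‖Complex.exp (t * w)‖ ^ 2 = Real.exp (t * (2 * w.re)) := by
  rw [Complex.norm_exp, ← Real.exp_nat_mul]
  congr 1
  simp
  ring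

/-- The eigenvectors of `B` are the columns of `X`. Their squared minors are the weights of the
initial data times exponentials, up to a constant that cancels in the quotient. The factor `2` in
`rate` comes from squaring the modulus of `exp(t g(z))`. -/
theorem coefficient_eq [NeZero n] {f : Polynomial ℂ} {C₀ B W Q : Matrix (Fin n) (Fin n) ℂ}
    {z : Fin n → ℂ} {t : ℝ} (h0 : IsShape 0 C₀) (h1 : IsShape 1 C₀ᴴ) (hC₀ : C₀ᴴ * C₀ = 1)
    (hQ : Qᴴ * Q = 1) (hCQ : C₀ * Q = Q * Matrix.diagonal z)
    (hW : ∀ i j, i < j → W i j = 0) (hBW : B * W = W * C₀)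
    (hX : (W * Q * expDiag (eulerPoly f) z t)ᴴ * (W * Q * expDiag (eulerPoly f) z t) = 1)
    {α : Fin n → ℂ} (hα : IsVerblunsky α) (hB : B = cmv α) (a : Fin n) :
    α a = (-1) ^ a.val *
      ((∑ I ∈ (Finset.univ : Finset (Fin n)).powersetCard (a.val + 1),
          ((weight z (fun j => ‖Q 0 j‖ ^ 2) I * Real.exp (t * ∑ i ∈ I, rate f (z i)) : ℝ) : ℂ)
            * conj (multi z I)) /
        ((∑ I ∈ (Finset.univ : Finset (Fin n)).powersetCard (a.val + 1),
          weight z (fun j => ‖Q 0 j‖ ^ 2) I * Real.exp (t * ∑ i ∈ I, rate f (z i)) : ℝ) : ℂ)) := by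
  set X := W * Q * expDiag (eulerPoly f) z t with hXdef
  have hX' : X * Xᴴ = 1 := mul_eq_one_comm.1 hX
  have hBX : B * X = X * Matrix.diagonal z := by
    have hE : Matrix.diagonal z * expDiag (eulerPoly f) z t
        = expDiag (eulerPoly f) z t * Matrix.diagonal z := by
      simp only [expDiag, Matrix.diagonal_mul_diagonal, mul_comm]
    rw [hXdef, ← mul_assoc, ← mul_assoc, hBW, mul_assoc W, hCQ, mul_assoc (W * Q), ← hE]
    simp only [mul_assoc]
  have hk : a.val + 1 ≤ n := a.isLt
  obtain ⟨c, hc, hcQ⟩ := exists_norm_minor_eq h0 h1 hC₀ hQ hCQ hk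
  -- The part of the squared minors that does not depend on the multi-index; it contains the unknown
  -- leading minor of `W`.
  set κ : ℝ := ‖(W.submatrix (Fin.castLE hk) (Fin.castLE hk)).det‖ ^ 2 / c ^ 2 with hκ
  let y : Finset (Fin n) → ℝ := fun I =>
    weight z (fun j => ‖Q 0 j‖ ^ 2) I * Real.exp (t * ∑ i ∈ I, rate f (z i))
  have hminor : ∀ e : Fin (a.val + 1) ↪o Fin n,
      ‖(X.submatrix (Fin.castLE hk) e).det‖ ^ 2 = κ * y (Finset.univ.map e.toEmbedding) := by
    intro e
    have h2 : (Q * expDiag (eulerPoly f) z t).submatrix (Fin.castLE hk) e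
        = Matrix.of fun i j => Complex.exp (t * (eulerPoly f).eval (z (e j)))
          * Q.submatrix (Fin.castLE hk) e i j := by
      ext i j
      simp [expDiag, Matrix.mul_diagonal, mul_comm]
    have h3 : ‖(Q.submatrix (Fin.castLE hk) e).det‖ ^ 2
        = weight z (fun j => ‖Q 0 j‖ ^ 2) (Finset.univ.map e.toEmbedding) / c ^ 2 := by
      rw [eq_div_iff (by positivity), mul_comm, ← mul_pow, hcQ, weight, vander_map, multi,
        Finset.prod_map, mul_pow, ← Finset.prod_pow, mul_comm]
      rfl
    have h4 : ∏ j, ‖Complex.exp (t * (eulerPoly f).eval (z (e j)))‖ ^ 2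
        = Real.exp (t * ∑ i ∈ Finset.univ.map e.toEmbedding, rate f (z i)) := by
      rw [Finset.sum_map, Finset.mul_sum, Real.exp_sum]
      refine Finset.prod_congr rfl fun j _ => ?_
      rw [norm_exp_sq]
      simp [rate, eulerPoly]
    rw [hXdef, mul_assoc, submatrix_castLE_lower_mul hk hW, h2, Matrix.det_mul, Matrix.det_mul_row,
      norm_mul, norm_mul, norm_prod, mul_pow, mul_pow, h3, ← Finset.prod_pow, h4]
    simp only [y, hκ]
    ring
  -- The same minor formula for the identity matrix `X Xᴴ` evaluates `κ` without solving for `W`.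
  have hone : κ * ∑ I ∈ (Finset.univ : Finset (Fin n)).powersetCard (a.val + 1), y I = 1 := by
    have h2 := det_leading_eq_sum (B := 1) (X := X) (d := fun _ => 1) (by simp [hX']) hk
    rw [Matrix.submatrix_one _ (Fin.castLE_injective hk), Matrix.det_one] at h2
    simp only [Finset.prod_const_one, mul_one, hminor] at h2
    rw [← Complex.ofReal_sum, sum_orderEmbedding (fun I => κ * y I), ← Finset.mul_sum] at h2
    exact_mod_cast h2.symm
  have hdet : (-1) ^ a.val * conj (α a)
      = κ * ∑ I ∈ (Finset.univ : Finset (Fin n)).powersetCard (a.val + 1), (y I : ℂ) * multi z I := by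
    rw [← det_leading_cmv hα a hk, ← hB,
      det_leading_eq_sum (mul_diagonal_conjTranspose_of_mul_eq hX hBX) hk,
      Finset.mul_sum, ← sum_orderEmbedding (fun I => (κ : ℂ) * ((y I : ℂ) * multi z I))]
    refine Finset.sum_congr rfl fun e _ => ?_
    rw [hminor, multi, Finset.prod_map]
    push_cast
    rw [mul_assoc]
    rfl
  have hne : κ ≠ 0 := left_ne_zero_of_mul_eq_one hone
  have hsum : ∑ I ∈ (Finset.univ : Finset (Fin n)).powersetCard (a.val + 1), y I = κ⁻¹ :=
    eq_inv_of_mul_eq_one_right hone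
  have hfin := congrArg conj hdet
  simp only [map_mul, map_pow, map_neg, map_one, RCLike.conj_conj, map_sum,
    Complex.conj_ofReal] at hfin
  have hsq : ((-1 : ℂ) ^ a.val) * (-1) ^ a.val = 1 := by
    rw [← mul_pow]
    simp
  change α a = (-1) ^ a.val * ((∑ I ∈ _, (y I : ℂ) * conj (multi z I)) / ((∑ I ∈ _, y I : ℝ) : ℂ))
  rw [hsum, Complex.ofReal_inv, div_inv_eq_mul, mul_comm _ (κ : ℂ), ← hfin, ← mul_assoc, hsq,
    one_mul]

end coefficients

/-! ### Averages with exponential weights -/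

section average
variable {ι : Type*}

/-- The average of `v` with the weights `w_i e^{t ℓ_i}`. -/
def expAverage (P : Finset ι) (w ℓ : ι → ℝ) (v : ι → ℂ) (t : ℝ) : ℂ :=
  (∑ i ∈ P, ((w i * Real.exp (t * ℓ i) : ℝ) : ℂ) * v i) /
    ((∑ i ∈ P, w i * Real.exp (t * ℓ i) : ℝ) : ℂ)

/-- A common exponential cancels in the quotient, so the largest exponent may be taken to be `0`. -/
theorem expAverage_shift (P : Finset ι) (w ℓ : ι → ℝ) (v : ι → ℂ) (M t : ℝ) :
    expAverage P w ℓ v t = expAverage P w (fun i => ℓ i - M) v t := by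
  have h : ∀ i, w i * Real.exp (t * ℓ i) = Real.exp (t * M) * (w i * Real.exp (t * (ℓ i - M))) := by
    intro i
    rw [mul_left_comm, ← Real.exp_add]
    congr 2
    ring
  have hne : ((Real.exp (t * M) : ℝ) : ℂ) ≠ 0 := Complex.ofReal_ne_zero.2 (Real.exp_ne_zero _)
  simp only [expAverage, h, Complex.ofReal_mul (Real.exp (t * M)), mul_assoc, ← Finset.mul_sum]
  rw [mul_div_mul_left _ _ hne]

theorem tendsto_exp_mul_nonpos {ℓ : ℝ} (h : ℓ ≤ 0) :
    Tendsto (fun t : ℝ => Real.exp (t * ℓ)) atTop (𝓝 (if ℓ = 0 then 1 else 0)) := by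
  rcases h.eq_or_lt with rfl | h
  · simp
  · rw [if_neg h.ne]
    exact Real.tendsto_exp_atBot.comp (tendsto_id.atTop_mul_const_of_neg h)

theorem tendsto_expAverage {P : Finset ι} {w ℓ : ι → ℝ} {M : ℝ} (hw : ∀ i ∈ P, 0 < w i)
    (hℓ : ∀ i ∈ P, ℓ i ≤ M) (hne : (P.filter fun i => ℓ i = M).Nonempty) (v : ι → ℂ) :
    Tendsto (expAverage P w ℓ v) atTop
      (𝓝 ((∑ i ∈ P.filter fun i => ℓ i = M, (w i : ℂ) * v i) /
        ((∑ i ∈ P.filter fun i => ℓ i = M, w i : ℝ) : ℂ))) := by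
  have hterm : ∀ i ∈ P, Tendsto (fun t : ℝ => w i * Real.exp (t * (ℓ i - M))) atTop
      (𝓝 (if ℓ i = M then w i else 0)) := by
    intro i hi
    have := (tendsto_exp_mul_nonpos (sub_nonpos.2 (hℓ i hi))).const_mul (w i)
    simpa [sub_eq_zero] using this
  have hden : Tendsto (fun t : ℝ => ((∑ i ∈ P, w i * Real.exp (t * (ℓ i - M)) : ℝ) : ℂ)) atTop
      (𝓝 ((∑ i ∈ P.filter fun i => ℓ i = M, w i : ℝ) : ℂ)) := by
    rw [Finset.sum_filter]
    exact (Complex.continuous_ofReal.tendsto _).comp (tendsto_finsetSum _ hterm)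
  have hnum : Tendsto (fun t : ℝ => ∑ i ∈ P, ((w i * Real.exp (t * (ℓ i - M)) : ℝ) : ℂ) * v i)
      atTop (𝓝 (∑ i ∈ P.filter fun i => ℓ i = M, (w i : ℂ) * v i)) := by
    rw [Finset.sum_filter]
    refine tendsto_finsetSum _ fun i hi => ?_
    have := ((Complex.continuous_ofReal.tendsto _).comp (hterm i hi)).mul_const (v i)
    have hite : (if ℓ i = M then (w i : ℂ) * v i else 0)
        = ((if ℓ i = M then w i else 0 : ℝ) : ℂ) * v i := by
      split_ifs <;> simp
    rw [hite]
    exact this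
  have hpos : (0 : ℝ) < ∑ i ∈ P.filter fun i => ℓ i = M, w i :=
    Finset.sum_pos (fun i hi => hw i (Finset.mem_filter.1 hi).1) hne
  exact (hnum.div hden (Complex.ofReal_ne_zero.2 hpos.ne')).congr fun t =>
    (expAverage_shift P w ℓ v M t).symm

/-- In the case of equality every `v i` would have to point in the direction of the sum `S`: the
nonnegative defects `‖S‖ - Re (v i * conj S)` have weighted sum zero. -/
theorem norm_weighted_sum_lt {P : Finset ι} {w : ι → ℝ} {v : ι → ℂ} (hw : ∀ i ∈ P, 0 < w i)
    (hv : ∀ i ∈ P, ‖v i‖ = 1) {i j : ι} (hi : i ∈ P) (hj : j ∈ P) (hij : v i ≠ v j) :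
    ‖∑ i ∈ P, (w i : ℂ) * v i‖ < ∑ i ∈ P, w i := by
  have hle : ‖∑ i ∈ P, (w i : ℂ) * v i‖ ≤ ∑ i ∈ P, w i := by
    refine (norm_sum_le _ _).trans (Finset.sum_le_sum fun i hi => ?_)
    rw [norm_mul, hv i hi, mul_one, Complex.norm_real, Real.norm_of_nonneg (hw i hi).le]
  refine lt_of_le_of_ne hle fun heq => ?_
  set S := ∑ i ∈ P, (w i : ℂ) * v i with hS
  have hpos : 0 < ‖S‖ := heq ▸ Finset.sum_pos hw ⟨i, hi⟩
  have h1 : ∑ i ∈ P, w i * (‖S‖ - (v i * conj S).re) = 0 := by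
    have h2 : (S * conj S).re = ∑ i ∈ P, w i * (v i * conj S).re := by
      conv_lhs => rw [hS, Finset.sum_mul, Complex.re_sum]
      refine Finset.sum_congr rfl fun i _ => ?_
      rw [mul_assoc, Complex.re_ofReal_mul]
    rw [Complex.mul_conj, Complex.ofReal_re, Complex.normSq_eq_norm_sq] at h2
    simp only [mul_sub, Finset.sum_sub_distrib, ← Finset.sum_mul, ← h2, ← heq]
    ring
  have hnorm : ∀ i ∈ P, ‖v i * conj S‖ = ‖S‖ := by
    intro i hi
    rw [norm_mul, hv i hi, one_mul, RCLike.norm_conj]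
  have hall : ∀ i ∈ P, v i * conj S = ‖S‖ := by
    intro i hi
    rw [Finset.sum_eq_zero_iff_of_nonneg] at h1
    · have h3 := (mul_eq_zero.1 (h1 i hi)).resolve_left (hw i hi).ne'
      have h4 : (v i * conj S).re = ‖v i * conj S‖ := by rw [hnorm i hi]; linarith
      have h5 := Complex.re_eq_norm.1 h4
      rw [Complex.eq_coe_norm_of_nonneg h5, hnorm i hi]
    · intro i hi
      refine mul_nonneg (hw i hi).le (sub_nonneg.2 ?_)
      exact (Complex.re_le_norm _).trans (hnorm i hi).le
  have hS0 : conj S ≠ 0 := by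
    rw [map_ne_zero]
    exact norm_pos_iff.1 hpos
  exact hij (mul_right_cancel₀ hS0 ((hall i hi).trans (hall j hj).symm))

theorem isBigO_exp_of_le {c γ : ℝ} (h : γ ≤ c) :
    (fun t : ℝ => Real.exp (t * -c)) =O[atTop] fun t => Real.exp (-γ * t) := by
  refine IsBigO.of_bound 1 ((eventually_ge_atTop 0).mono fun t ht => ?_)
  rw [Real.norm_of_nonneg (Real.exp_nonneg _), Real.norm_of_nonneg (Real.exp_nonneg _), one_mul]
  exact Real.exp_le_exp.2 (by nlinarith)

/-- The first correction to the limit, when there are a largest and a second largest exponent. -/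
theorem expAverage_expansion [DecidableEq ι] {P : Finset ι} {w ℓ : ι → ℝ} (hw : ∀ i ∈ P, 0 < w i)
    (v : ι → ℂ) {i₀ i₁ : ι} (h₀ : i₀ ∈ P) (h₁ : i₁ ∈ P) (hlt : ℓ i₁ < ℓ i₀)
    (hrest : ∀ i ∈ P, i ≠ i₀ → i ≠ i₁ → ℓ i < ℓ i₁) :
    ∃ γ : ℝ, ℓ i₀ - ℓ i₁ < γ ∧
      (fun t : ℝ => expAverage P w ℓ v t -
        (v i₀ + (v i₁ - v i₀) * ((w i₁ / w i₀ : ℝ) : ℂ) *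
          (Real.exp (-(ℓ i₀ - ℓ i₁) * t) : ℂ))) =O[atTop] fun t : ℝ => Real.exp (-γ * t) := by
  set g := ℓ i₀ - ℓ i₁ with hg
  have hg0 : 0 < g := sub_pos.2 hlt
  set R := (P.erase i₀).erase i₁ with hR
  have hRmem : ∀ i ∈ R, i ≠ i₁ ∧ i ≠ i₀ ∧ i ∈ P := fun i hi => by simpa [hR] using hi
  -- The error consists of the square of the first correction, of rate `2g`, and of the finitely
  -- many remaining terms, whose rates all exceed `g`. Some `γ > g` lies below all of them.
  obtain ⟨γ, hγg, hγ2, hγR⟩ : ∃ γ, g < γ ∧ γ ≤ 2 * g ∧ ∀ i ∈ R, γ ≤ ℓ i₀ - ℓ i := by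
    have h1 : ∀ᶠ γ in 𝓝[>] g, γ ≤ 2 * g :=
      nhdsWithin_le_nhds (Iic_mem_nhds (by linarith))
    have h2 : ∀ᶠ γ in 𝓝[>] g, ∀ i ∈ R, γ ≤ ℓ i₀ - ℓ i := by
      rw [Filter.eventually_all_finset]
      intro i hi
      obtain ⟨hi1, hi0, hiP⟩ := hRmem i hi
      exact nhdsWithin_le_nhds (Iic_mem_nhds (by have := hrest i hiP hi0 hi1; linarith))
    obtain ⟨γ, ⟨h3, h4⟩, h5⟩ := ((h1.and h2).and self_mem_nhdsWithin).exists
    exact ⟨γ, h5, h3, h4⟩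
  refine ⟨γ, hγg, ?_⟩
  have hw₀ := hw i₀ h₀
  have hw₀c : (w i₀ : ℂ) ≠ 0 := Complex.ofReal_ne_zero.2 hw₀.ne'
  let x : ι → ℝ → ℂ := fun i t => ((w i * Real.exp (t * (ℓ i - ℓ i₀)) : ℝ) : ℂ)
  let D : ℝ → ℝ := fun t => ∑ i ∈ P, w i * Real.exp (t * (ℓ i - ℓ i₀))
  have hD : ∀ t, w i₀ ≤ D t := by
    intro t
    have := Finset.single_le_sum (f := fun i => w i * Real.exp (t * (ℓ i - ℓ i₀)))
      (fun i hi => mul_nonneg (hw i hi).le (Real.exp_nonneg _)) h₀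
    simpa using this
  have hx : ∀ i, γ ≤ ℓ i₀ - ℓ i → (x i) =O[atTop] fun t : ℝ => Real.exp (-γ * t) := by
    intro i hi
    refine IsBigO.of_norm_left ?_
    simp only [x, Complex.norm_real]
    refine IsBigO.norm_left ?_
    have := (isBigO_exp_of_le hi).const_mul_left (w i)
    simpa using this
  have hsplit : ∀ F : ι → ℂ, ∑ i ∈ P, F i = F i₀ + F i₁ + ∑ i ∈ R, F i := by
    intro F
    have h1' : i₁ ∈ P.erase i₀ := Finset.mem_erase.2 ⟨by rintro rfl; exact lt_irrefl _ hlt, h₁⟩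
    rw [← Finset.add_sum_erase _ _ h₀, ← Finset.add_sum_erase _ _ h1', add_assoc]
  let ε : ℝ → ℂ := fun t => (Real.exp (-g * t) : ℂ)
  have hx₀ : ∀ t, x i₀ t = w i₀ := by simp [x]
  have hx₁ : ∀ t, x i₁ t = w i₁ * ε t := by
    intro t
    simp only [x, ε, hg]
    push_cast
    congr 2
    ring
  -- After multiplication by the denominator `D`, the terms of order `1` and `ε` cancel exactly.
  -- What is left has a factor `ε²` or a term from `R`.
  have herr : ∀ t, expAverage P w ℓ v t -
        (v i₀ + (v i₁ - v i₀) * ((w i₁ / w i₀ : ℝ) : ℂ) * ε t)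
      = (∑ i ∈ R, (x i t * (v i - v i₀) - x i t * (v i₁ - v i₀) * ((w i₁ / w i₀ : ℝ) : ℂ) * ε t)
        - (v i₁ - v i₀) * ((w i₁ / w i₀ : ℝ) : ℂ) * (w i₁ : ℂ) * (ε t * ε t)) * ((D t : ℝ) : ℂ)⁻¹ := by
    intro t
    have hDt : ((D t : ℝ) : ℂ) ≠ 0 := Complex.ofReal_ne_zero.2 (hw₀.trans_le (hD t)).ne'
    rw [expAverage_shift P w ℓ v (ℓ i₀) t, ← div_eq_mul_inv, eq_div_iff hDt, sub_mul, expAverage]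
    change ((∑ i ∈ P, x i t * v i) / ((D t : ℝ) : ℂ)) * ((D t : ℝ) : ℂ) - _ = _
    rw [div_mul_cancel₀ _ hDt]
    have hDs : ((D t : ℝ) : ℂ) = ∑ i ∈ P, x i t := by simp [D, x]
    rw [hDs, hsplit, hsplit, hx₀, hx₁, Finset.sum_sub_distrib]
    have h3 : ∑ i ∈ R, x i t * (v i₁ - v i₀) * ((w i₁ / w i₀ : ℝ) : ℂ) * ε t
        = (∑ i ∈ R, x i t) * ((v i₁ - v i₀) * ((w i₁ / w i₀ : ℝ) : ℂ) * ε t) := by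
      rw [Finset.sum_mul]
      exact Finset.sum_congr rfl fun i _ => by ring
    have h4 : ∑ i ∈ R, x i t * (v i - v i₀) = ∑ i ∈ R, x i t * v i - (∑ i ∈ R, x i t) * v i₀ := by
      rw [Finset.sum_mul, ← Finset.sum_sub_distrib]
      exact Finset.sum_congr rfl fun i _ => by ring
    rw [h3, h4]
    push_cast
    field_simp
    ring
  have hDinv : (fun t => ((D t : ℝ) : ℂ)⁻¹) =O[atTop] fun _ => (1 : ℝ) := by
    refine IsBigO.of_bound (w i₀)⁻¹ (Eventually.of_forall fun t => ?_)
    rw [norm_inv, Complex.norm_real, Real.norm_of_nonneg (hw₀.le.trans (hD t)), norm_one, mul_one]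
    exact inv_anti₀ hw₀ (hD t)
  have hε1 : ε =O[atTop] fun _ => (1 : ℝ) := by
    refine IsBigO.of_bound 1 ((eventually_ge_atTop 0).mono fun t ht => ?_)
    simp only [ε, Complex.norm_real, norm_one, mul_one]
    rw [Real.norm_of_nonneg (Real.exp_nonneg _)]
    exact Real.exp_le_one_iff.2 (by nlinarith)
  have hε2 : (fun t => ε t * ε t) =O[atTop] fun t : ℝ => Real.exp (-γ * t) := by
    refine IsBigO.of_norm_left ?_
    have h5 : ∀ t, ‖ε t * ε t‖ = ‖Real.exp (t * -(2 * g))‖ := by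
      intro t
      simp only [ε]
      rw [← Complex.ofReal_mul, ← Real.exp_add, Complex.norm_real]
      congr 2
      ring
    simp only [h5]
    exact (isBigO_exp_of_le hγ2).norm_left
  have hmain : (fun t => (∑ i ∈ R, (x i t * (v i - v i₀)
        - x i t * (v i₁ - v i₀) * ((w i₁ / w i₀ : ℝ) : ℂ) * ε t)
        - (v i₁ - v i₀) * ((w i₁ / w i₀ : ℝ) : ℂ) * (w i₁ : ℂ) * (ε t * ε t)))
      =O[atTop] fun t : ℝ => Real.exp (-γ * t) := by
    refine IsBigO.sub (IsBigO.fun_sum fun i hi => ?_) (hε2.const_mul_left _)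
    have hxi := hx i (hγR i hi)
    have h6 : (fun t => x i t * (v i - v i₀)) =O[atTop] fun t : ℝ => Real.exp (-γ * t) := by
      simpa [mul_comm] using hxi.const_mul_left (v i - v i₀)
    have h7 := (hxi.const_mul_left ((v i₁ - v i₀) * ((w i₁ / w i₀ : ℝ) : ℂ))).mul hε1
    refine h6.sub ?_
    simpa [mul_comm, mul_assoc, mul_left_comm] using h7
  have := hmain.mul hDinv
  simp only [mul_one] at this
  exact this.congr_left fun t => (herr t).symm

end average

/-! ### The leading multi-indices -/

section multiindex
variable {n : ℕ} {lam : Fin n → ℝ} {z : Fin n → ℂ} {μ : Fin n → ℝ} {a b : Fin n}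

theorem above_subset (hanti : Antitone lam) (a : Fin n) : above lam a ⊆ Finset.Iio a := by
  intro l hl
  rw [Finset.mem_Iio]
  by_contra h
  exact absurd (hanti (not_lt.1 h)) (not_le.2 (Finset.mem_filter.1 hl).2)

theorem card_above_le (hanti : Antitone lam) (a : Fin n) : (above lam a).card ≤ a.val := by
  simpa using Finset.card_le_card (above_subset hanti a)

theorem disjoint_above_tied (lam : Fin n → ℝ) (a : Fin n) : Disjoint (above lam a) (tied lam a) := by
  rw [Finset.disjoint_left]
  intro l h1 h2
  exact (Finset.mem_filter.1 h1).2.ne' (Finset.mem_filter.1 h2).2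

theorem mem_above_union_tied {l : Fin n} : l ∈ above lam a ∪ tied lam a ↔ lam a ≤ lam l := by
  simp only [above, tied, Finset.mem_union, Finset.mem_filter, Finset.mem_univ, true_and]
  rw [le_iff_lt_or_eq, eq_comm]

/-- All indices up to `b` lie in `J ∪ B_a`. With `b = a` this leaves enough indices for one choice
of `I`; with `b = a + 1` there is one to spare. -/
theorem card_le_above_add_tied (hanti : Antitone lam) (hab : lam b = lam a) :
    b.val + 1 ≤ (above lam a).card + (tied lam a).card := by
  rw [← Finset.card_union_of_disjoint (disjoint_above_tied lam a), ← Fin.card_Iic]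
  refine Finset.card_le_card fun l hl => mem_above_union_tied.2 ?_
  rw [← hab]
  exact hanti (Finset.mem_Iic.1 hl)

theorem disjoint_of_mem_choices {I : Finset (Fin n)} (hI : I ∈ choices lam a) :
    Disjoint (above lam a) I :=
  (disjoint_above_tied lam a).mono_right (Finset.mem_powersetCard.1 hI).1

theorem choices_nonempty (hanti : Antitone lam) (a : Fin n) : (choices lam a).Nonempty := by
  rw [choices, Finset.powersetCard_nonempty]
  have := card_le_above_add_tied hanti (rfl : lam a = lam a)
  omega

/-- The sum of the largest `a + 1` exponents. -/
def topSum (lam : Fin n → ℝ) (a : Fin n) : ℝ :=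
  ∑ i ∈ above lam a, (lam i - lam a) + (a.val + 1) * lam a

/-- Measured from the level `lam a`, the sum falls short of `topSum` in two ways: by chosen indices
below the level and by omitted indices above it. Both defects have a definite sign, which gives the
maximum and all maximizers. -/
theorem sum_eq_of_card {I : Finset (Fin n)} (hI : I.card = a.val + 1) :
    ∑ i ∈ I, lam i = topSum lam a + (∑ i ∈ I \ above lam a, (lam i - lam a)
      - ∑ i ∈ above lam a \ I, (lam i - lam a)) := by
  rw [Finset.sum_sdiff_sub_sum_sdiff, topSum, Finset.sum_sub_distrib (s := I), Finset.sum_const, hI]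
  simp only [nsmul_eq_mul]
  push_cast
  ring

theorem sdiff_above_nonpos {I : Finset (Fin n)} : ∀ i ∈ I \ above lam a, lam i - lam a ≤ 0 := by
  intro i hi
  have := (Finset.mem_sdiff.1 hi).2
  simp only [above, Finset.mem_filter, Finset.mem_univ, true_and, not_lt] at this
  linarith

theorem above_sdiff_pos {I : Finset (Fin n)} : ∀ i ∈ above lam a \ I, 0 < lam i - lam a :=
  fun _ hi => sub_pos.2 (Finset.mem_filter.1 (Finset.mem_sdiff.1 hi).1).2

theorem sum_le_topSum {I : Finset (Fin n)} (hI : I.card = a.val + 1) :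
    ∑ i ∈ I, lam i ≤ topSum lam a := by
  rw [sum_eq_of_card hI]
  have h1 := Finset.sum_nonpos (sdiff_above_nonpos (lam := lam) (a := a) (I := I))
  have h2 := Finset.sum_nonneg fun i hi => (above_sdiff_pos (lam := lam) (a := a) (I := I) i hi).le
  linarith

theorem sum_eq_topSum_iff {I : Finset (Fin n)} (hI : I.card = a.val + 1) :
    ∑ i ∈ I, lam i = topSum lam a ↔ above lam a ⊆ I ∧ I \ above lam a ⊆ tied lam a := by
  have h1 := Finset.sum_nonpos (sdiff_above_nonpos (lam := lam) (a := a) (I := I))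
  have h2 := Finset.sum_nonneg fun i hi => (above_sdiff_pos (lam := lam) (a := a) (I := I) i hi).le
  rw [sum_eq_of_card hI]
  constructor
  · intro h
    have h3 : ∑ i ∈ I \ above lam a, (lam i - lam a) = 0 := by linarith
    have h4 : ∑ i ∈ above lam a \ I, (lam i - lam a) = 0 := by linarith
    rw [Finset.sum_eq_zero_iff_of_nonpos sdiff_above_nonpos] at h3
    rw [Finset.sum_eq_zero_iff_of_nonneg fun i hi => (above_sdiff_pos i hi).le] at h4
    refine ⟨fun i hi => ?_, fun i hi => ?_⟩
    · by_contra hiI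
      have hm := Finset.mem_sdiff.2 ⟨hi, hiI⟩
      exact (above_sdiff_pos i hm).ne' (h4 i hm)
    · exact Finset.mem_filter.2 ⟨Finset.mem_univ _, sub_eq_zero.1 (h3 i hi)⟩
  · rintro ⟨h3, h4⟩
    rw [Finset.sdiff_eq_empty_iff_subset.2 h3, Finset.sum_empty, Finset.sum_eq_zero]
    · simp
    · intro i hi
      exact sub_eq_zero.2 (Finset.mem_filter.1 (h4 hi)).2

theorem sum_filter_topSum (hanti : Antitone lam) {M : Type*} [AddCommMonoid M]
    (F : Finset (Fin n) → M) :
    ∑ I ∈ ((Finset.univ : Finset (Fin n)).powersetCard (a.val + 1)).filter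
        (fun I => ∑ i ∈ I, lam i = topSum lam a), F I
      = ∑ I ∈ choices lam a, F (above lam a ∪ I) := by
  have hJ := card_above_le hanti a
  symm
  refine Finset.sum_bij' (fun I _ => above lam a ∪ I) (fun I _ => I \ above lam a) ?_ ?_ ?_ ?_ ?_
  · intro I hI
    obtain ⟨h1, h2⟩ := Finset.mem_powersetCard.1 hI
    have hd := disjoint_of_mem_choices hI
    have hc : (above lam a ∪ I).card = a.val + 1 := by
      rw [Finset.card_union_of_disjoint hd, h2]
      omega
    rw [Finset.mem_filter, Finset.mem_powersetCard, sum_eq_topSum_iff hc,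
      Finset.union_sdiff_cancel_left hd]
    exact ⟨⟨Finset.subset_univ _, hc⟩, Finset.subset_union_left, h1⟩
  · intro I hI
    obtain ⟨h1, h2⟩ := Finset.mem_filter.1 hI
    have hc := (Finset.mem_powersetCard.1 h1).2
    obtain ⟨h3, h4⟩ := (sum_eq_topSum_iff hc).1 h2
    refine Finset.mem_powersetCard.2 ⟨h4, ?_⟩
    rw [Finset.card_sdiff_of_subset h3, hc]
  · intro I hI
    exact Finset.union_sdiff_cancel_left (disjoint_of_mem_choices hI)
  · intro I hI
    obtain ⟨h1, h2⟩ := Finset.mem_filter.1 hI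
    exact Finset.union_sdiff_of_subset
      ((sum_eq_topSum_iff (Finset.mem_powersetCard.1 h1).2).1 h2).1
  · intro I _
    rfl

theorem multi_union {M : Type} [CommMonoid M] (x : Fin n → M) {I J : Finset (Fin n)}
    (h : Disjoint I J) : multi x (I ∪ J) = multi x I * multi x J :=
  Finset.prod_union h

theorem vander_ne_zero (hz : Function.Injective z) (I : Finset (Fin n)) : vander z I ≠ 0 := by
  rw [vander, Finset.prod_ne_zero_iff]
  intro p hp
  rw [sub_ne_zero]
  exact fun h => (Finset.mem_filter.1 hp).2.ne' (hz h)

theorem multi_pos (hμ : ∀ j, 0 < μ j) (I : Finset (Fin n)) : 0 < multi μ I :=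
  Finset.prod_pos fun i _ => hμ i

theorem weight_pos (hz : Function.Injective z) (hμ : ∀ j, 0 < μ j) (I : Finset (Fin n)) :
    0 < weight z μ I :=
  mul_pos (pow_pos (norm_pos_iff.2 (vander_ne_zero hz I)) 2) (multi_pos hμ I)

theorem norm_multi (hz : ∀ j, ‖z j‖ = 1) (I : Finset (Fin n)) : ‖multi z I‖ = 1 := by
  rw [multi, norm_prod]
  exact Finset.prod_eq_one fun i _ => hz i

/-- Every maximizing multi-index contains `J`, so `μ_J` cancels in the quotient and `conj z_J` can
be pulled out. -/
theorem limitValue_eq (hμ : ∀ j, 0 < μ j) (hanti : Antitone lam) :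
    limitValue lam z μ a = (-1) ^ a.val *
      ((∑ I ∈ ((Finset.univ : Finset (Fin n)).powersetCard (a.val + 1)).filter
          (fun I => ∑ i ∈ I, lam i = topSum lam a), (weight z μ I : ℂ) * conj (multi z I)) /
        ((∑ I ∈ ((Finset.univ : Finset (Fin n)).powersetCard (a.val + 1)).filter
          (fun I => ∑ i ∈ I, lam i = topSum lam a), weight z μ I : ℝ) : ℂ)) := by
  rw [sum_filter_topSum hanti, sum_filter_topSum hanti]
  have hJ : ((multi μ (above lam a) : ℝ) : ℂ) ≠ 0 :=
    Complex.ofReal_ne_zero.2 (multi_pos hμ _).ne'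
  have h1 : ∀ I ∈ choices lam a, weight z μ (above lam a ∪ I)
      = multi μ (above lam a) * (‖vander z (above lam a ∪ I)‖ ^ 2 * multi μ I) := by
    intro I hI
    rw [weight, multi_union μ (disjoint_of_mem_choices hI)]
    ring
  have h2 : ∀ I ∈ choices lam a, (weight z μ (above lam a ∪ I) : ℂ)
        * conj (multi z (above lam a ∪ I))
      = ((multi μ (above lam a) : ℝ) : ℂ) * (conj (multi z (above lam a)) *
        (((‖vander z (above lam a ∪ I)‖ ^ 2 * multi μ I : ℝ) : ℂ) * conj (multi z I))) := by
    intro I hI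
    rw [h1 I hI, multi_union z (disjoint_of_mem_choices hI), map_mul, Complex.ofReal_mul]
    ring
  rw [Finset.sum_congr rfl h1, Finset.sum_congr rfl h2, ← Finset.mul_sum, ← Finset.mul_sum,
    ← Finset.mul_sum, Complex.ofReal_mul, mul_div_mul_left _ _ hJ, limitValue]
  ring

/-- The limit is an average of unimodular numbers. If `lam b < lam a`, then `I = B_a` is the only
choice. If there is a tie, two choices have different products, and the strict triangle inequality
applies. -/
theorem norm_limitValue_eq_one_iff (hz : Function.Injective z) (hz1 : ∀ j, ‖z j‖ = 1)
    (hμ : ∀ j, 0 < μ j) (hanti : Antitone lam) (hab : b.val = a.val + 1) :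
    ‖limitValue lam z μ a‖ = 1 ↔ lam b < lam a := by
  have hJ := card_above_le hanti a
  have hpos : ∀ I ∈ choices lam a, 0 < ‖vander z (above lam a ∪ I)‖ ^ 2 * multi μ I := fun I _ =>
    mul_pos (pow_pos (norm_pos_iff.2 (vander_ne_zero hz _)) 2) (multi_pos hμ I)
  have hsum := Finset.sum_pos hpos (choices_nonempty hanti a)
  have hnorm : ‖limitValue lam z μ a‖ = ‖∑ I ∈ choices lam a,
      ((‖vander z (above lam a ∪ I)‖ ^ 2 * multi μ I : ℝ) : ℂ) * conj (multi z I)‖ /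
      ∑ I ∈ choices lam a, ‖vander z (above lam a ∪ I)‖ ^ 2 * multi μ I := by
    rw [limitValue, norm_mul, norm_mul, norm_pow, norm_neg, norm_one, one_pow, RCLike.norm_conj,
      norm_multi hz1, norm_div, Complex.norm_real, Real.norm_of_nonneg hsum.le, one_mul, one_mul]
  rw [hnorm, div_eq_one_iff_eq hsum.ne']
  constructor
  · intro heq
    by_contra hlt
    have hba : lam b = lam a :=
      le_antisymm (hanti (by rw [Fin.le_def]; omega)) (not_lt.1 hlt)
    have hne : a ≠ b := by
      rintro rfl
      omega
    have ha : a ∈ tied lam a := Finset.mem_filter.2 ⟨Finset.mem_univ _, rfl⟩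
    have hb : b ∈ tied lam a := Finset.mem_filter.2 ⟨Finset.mem_univ _, hba⟩
    have hcard := card_le_above_add_tied hanti hba
    -- The set `K` is one element short of a choice and avoids `a` and `b`; completing it with `a`
    -- or with `b` gives two choices whose products differ because `z a ≠ z b`.
    obtain ⟨K, hK, hKc⟩ := Finset.exists_subset_card_eq
      (s := ((tied lam a).erase a).erase b) (n := a.val - (above lam a).card) (by
        rw [Finset.card_erase_of_mem (Finset.mem_erase.2 ⟨hne.symm, hb⟩),
          Finset.card_erase_of_mem ha]
        omega)
    have hKa : a ∉ K := fun h => by simpa using hK h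
    have hKb : b ∉ K := fun h => by simpa using hK h
    have hKt : K ⊆ tied lam a :=
      hK.trans ((Finset.erase_subset _ _).trans (Finset.erase_subset _ _))
    have hIa : insert a K ∈ choices lam a := Finset.mem_powersetCard.2
      ⟨Finset.insert_subset ha hKt, by rw [Finset.card_insert_of_notMem hKa, hKc]; omega⟩
    have hIb : insert b K ∈ choices lam a := Finset.mem_powersetCard.2
      ⟨Finset.insert_subset hb hKt, by rw [Finset.card_insert_of_notMem hKb, hKc]; omega⟩
    refine (norm_weighted_sum_lt hpos (v := fun I => conj (multi z I))
      (fun I _ => by rw [RCLike.norm_conj, norm_multi hz1]) hIa hIb ?_).ne heq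
    intro h
    have h' := (starRingEnd ℂ).injective h
    rw [multi, multi, Finset.prod_insert hKa, Finset.prod_insert hKb] at h'
    have hK0 : ∏ i ∈ K, z i ≠ 0 := by
      rw [← norm_ne_zero_iff]
      change ‖multi z K‖ ≠ 0
      rw [norm_multi hz1]
      exact one_ne_zero
    exact hne (hz (mul_right_cancel₀ hK0 h'))
  · intro hlt
    have hle : (above lam a).card + (tied lam a).card ≤ a.val + 1 := by
      rw [← Finset.card_union_of_disjoint (disjoint_above_tied lam a), ← Fin.card_Iic]
      refine Finset.card_le_card fun l hl => ?_
      rw [mem_above_union_tied] at hl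
      rw [Finset.mem_Iic, Fin.le_def]
      by_contra h
      have : lam l ≤ lam b := hanti (by rw [Fin.le_def]; omega)
      linarith
    have hge := card_le_above_add_tied hanti (rfl : lam a = lam a)
    have hch : choices lam a = {tied lam a} := by
      rw [choices, show a.val + 1 - (above lam a).card = (tied lam a).card by omega,
        Finset.powersetCard_self]
    rw [hch, Finset.sum_singleton, Finset.sum_singleton, norm_mul, RCLike.norm_conj,
      norm_multi hz1, mul_one, Complex.norm_real, Real.norm_of_nonneg]
    exact (mul_pos (pow_pos (norm_pos_iff.2 (vander_ne_zero hz _)) 2) (multi_pos hμ _)).le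

theorem vander_insert (z : Fin n → ℂ) {x : Fin n} {K : Finset (Fin n)} (hK : ∀ i ∈ K, i < x) :
    vander z (insert x K) = vander z K * ∏ i ∈ K, (z x - z i) := by
  have hx : x ∉ K := fun h => lt_irrefl _ (hK x h)
  simp only [vander, Finset.prod_filter, Finset.prod_product]
  rw [Finset.prod_insert hx, Finset.prod_eq_one, one_mul, ← Finset.prod_mul_distrib]
  · refine Finset.prod_congr rfl fun i hi => ?_
    rw [Finset.prod_insert hx, if_pos (hK i hi), mul_comm]
  · intro j hj
    rcases Finset.mem_insert.1 hj with rfl | hj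
    · simp
    · rw [if_neg (hK j hj).not_gt]

theorem weight_insert_Iio (z : Fin n → ℂ) (μ : Fin n → ℝ) {x : Fin n} (hx : a ≤ x) :
    weight z μ (insert x (Finset.Iio a)) = weight z μ (Finset.Iio a) *
      (μ x * ∏ l ∈ Finset.Iio a, ‖z x - z l‖ ^ 2) := by
  have hnot : x ∉ Finset.Iio a := by simpa using hx
  rw [weight, weight, vander_insert z fun i hi => (Finset.mem_Iio.1 hi).trans_le hx, norm_mul,
    norm_prod, mul_pow, ← Finset.prod_pow, multi, multi, Finset.prod_insert hnot]
  ring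

/-- A set other than the best one contains some `x > a`, which already costs at least `lam a - lam
b`. Either it also omits an index before `a`, at a further cost, or it is `{l < a} ∪ {x}` with `x`
beyond `b`. -/
theorem sum_lt_of_ne_of_ne (hlam : StrictAnti lam) (hab : b.val = a.val + 1) {I : Finset (Fin n)}
    (hI : I.card = a.val + 1) (h₀ : I ≠ insert a (Finset.Iio a))
    (h₁ : I ≠ insert b (Finset.Iio a)) :
    ∑ i ∈ I, lam i < ∑ i ∈ insert b (Finset.Iio a), lam i := by
  have hJ : above lam a = Finset.Iio a := by
    ext l
    simp [above, hlam.lt_iff_gt]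
  have hbJ : b ∉ Finset.Iio a := by simp [Fin.le_def, hab]
  have hbc : (insert b (Finset.Iio a)).card = a.val + 1 := by
    rw [Finset.card_insert_of_notMem hbJ, Fin.card_Iio]
  have hb : ∑ i ∈ insert b (Finset.Iio a), lam i = topSum lam a + (lam b - lam a) := by
    rw [sum_eq_of_card hbc, hJ, Finset.insert_sdiff_of_notMem _ hbJ, Finset.sdiff_self,
      Finset.sdiff_eq_empty_iff_subset.2 (Finset.subset_insert _ _)]
    simp
  rw [sum_eq_of_card hI, hb]
  obtain ⟨x, hxI, hxa⟩ : ∃ x ∈ I, a < x := by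
    by_contra h
    push Not at h
    apply h₀
    refine Finset.eq_of_subset_of_card_le (fun i hi => ?_) ?_
    · rw [Finset.Iio_insert, Finset.mem_Iic]
      exact h i hi
    · rw [hI, Finset.Iio_insert, Fin.card_Iic]
  have hbx : b ≤ x := by
    have : a.val < x.val := hxa
    rw [Fin.le_def]
    omega
  have hxm : x ∈ I \ above lam a := by
    rw [hJ, Finset.mem_sdiff, Finset.mem_Iio]
    exact ⟨hxI, hxa.not_gt⟩
  have hsum1 : ∑ i ∈ I \ above lam a, (lam i - lam a) ≤ lam x - lam a := by
    rw [← Finset.add_sum_erase _ _ hxm]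
    have := Finset.sum_nonpos (f := fun i => lam i - lam a) (s := (I \ above lam a).erase x)
      fun i hi => sdiff_above_nonpos i (Finset.mem_of_mem_erase hi)
    linarith
  have hxb : lam x ≤ lam b := hlam.antitone hbx
  by_cases hsub : above lam a ⊆ I
  · rw [Finset.sdiff_eq_empty_iff_subset.2 hsub, Finset.sum_empty, sub_zero]
    have hc : (I \ above lam a).card = 1 := by
      rw [Finset.card_sdiff_of_subset hsub, hI, hJ, Fin.card_Iio]
      omega
    have hxne : x ≠ b := by
      rintro rfl
      apply h₁
      obtain ⟨y, hy⟩ := Finset.card_eq_one.1 hc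
      rw [hy, Finset.mem_singleton] at hxm
      rw [← Finset.sdiff_union_of_subset hsub, hy, ← hxm, hJ]
      rfl
    have := hlam (lt_of_le_of_ne hbx hxne.symm)
    linarith
  · have hpos : 0 < ∑ i ∈ above lam a \ I, (lam i - lam a) :=
      Finset.sum_pos above_sdiff_pos (Finset.sdiff_nonempty.2 hsub)
    linarith

end multiindex

/-! ### Limit and first correction of the averages over multi-indices. -/

section asymptotics
variable {n : ℕ} {lam : Fin n → ℝ} {z : Fin n → ℂ} {μ : Fin n → ℝ} {a b : Fin n}

/-- The family of the multi-indices with `a + 1` elements. -/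
def multiIndices (a : Fin n) : Finset (Finset (Fin n)) :=
  (Finset.univ : Finset (Fin n)).powersetCard (a.val + 1)

theorem tendsto_limitValue (hz : Function.Injective z) (hμ : ∀ j, 0 < μ j) (hanti : Antitone lam) :
    Tendsto (fun t => (-1) ^ a.val * expAverage (multiIndices a) (weight z μ)
      (fun I => ∑ i ∈ I, lam i) (fun I => conj (multi z I)) t) atTop
      (𝓝 (limitValue lam z μ a)) := by
  rw [limitValue_eq hμ hanti]
  refine (tendsto_expAverage (fun I _ => weight_pos hz hμ I)
    (fun I hI => sum_le_topSum (Finset.mem_powersetCard.1 hI).2) ?_ _).const_mul _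
  have hcard : ((multiIndices a).filter fun I => ∑ i ∈ I, lam i = topSum lam a).card
      = (choices lam a).card := by
    rw [Finset.card_eq_sum_ones, Finset.card_eq_sum_ones]
    exact sum_filter_topSum hanti fun _ => 1
  exact Finset.card_pos.1 (hcard ▸ Finset.card_pos.2 (choices_nonempty hanti a))

theorem expansion_of_injective (hz : Function.Injective z) (hz1 : ∀ j, ‖z j‖ = 1)
    (hμ : ∀ j, 0 < μ j) (hanti : Antitone lam) (hinj : Function.Injective lam)
    (hab : b.val = a.val + 1) :
    0 < lam a - lam b ∧ ∃ γ : ℝ, lam a - lam b < γ ∧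
      (fun t : ℝ => (-1) ^ a.val * expAverage (multiIndices a) (weight z μ)
          (fun I => ∑ i ∈ I, lam i) (fun I => conj (multi z I)) t
        - (-1) ^ a.val * conj (multi z (Finset.Iic a)) *
          (1 + xi z μ a b * (Real.exp (-(lam a - lam b) * t) : ℂ)))
        =O[atTop] fun t : ℝ => Real.exp (-γ * t) := by
  have hstrict : StrictAnti lam := hanti.strictAnti_of_injective hinj
  have hlt : a < b := by
    rw [Fin.lt_def]
    omega
  have haJ : a ∉ Finset.Iio a := by simp
  have hbJ : b ∉ Finset.Iio a := by simpa using hlt.le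
  set I₀ := insert a (Finset.Iio a) with hI₀
  set I₁ := insert b (Finset.Iio a) with hI₁
  have h₀ : I₀ ∈ multiIndices a := Finset.mem_powersetCard.2
    ⟨Finset.subset_univ _, by rw [hI₀, Finset.card_insert_of_notMem haJ, Fin.card_Iio]⟩
  have h₁ : I₁ ∈ multiIndices a := Finset.mem_powersetCard.2
    ⟨Finset.subset_univ _, by rw [hI₁, Finset.card_insert_of_notMem hbJ, Fin.card_Iio]⟩
  have hdiff : ∑ i ∈ I₀, lam i - ∑ i ∈ I₁, lam i = lam a - lam b := by
    rw [hI₀, hI₁, Finset.sum_insert haJ, Finset.sum_insert hbJ]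
    ring
  have hpos : 0 < lam a - lam b := sub_pos.2 (hstrict hlt)
  obtain ⟨γ, hγ, hO⟩ := expAverage_expansion (P := multiIndices a) (w := weight z μ)
    (ℓ := fun I => ∑ i ∈ I, lam i) (fun I _ => weight_pos hz hμ I) (fun I => conj (multi z I))
    h₀ h₁ (by linarith)
    (fun I hI hne₀ hne₁ => sum_lt_of_ne_of_ne hstrict hab (Finset.mem_powersetCard.1 hI).2 hne₀ hne₁)
  simp only [hdiff] at hγ hO
  refine ⟨hpos, γ, hγ, ?_⟩
  have hzc : z a * conj (z a) = 1 := by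
    rw [Complex.mul_conj, Complex.normSq_eq_norm_sq, hz1]
    simp
  have hw : weight z μ I₁ / weight z μ I₀
      = μ b / μ a * ∏ l ∈ Finset.Iio a, ‖(z b - z l) / (z a - z l)‖ ^ 2 := by
    rw [hI₀, hI₁, weight_insert_Iio z μ le_rfl, weight_insert_Iio z μ hlt.le,
      mul_div_mul_left _ _ (weight_pos hz hμ _).ne', mul_div_mul_comm, ← Finset.prod_div_distrib]
    simp only [norm_div, div_pow]
  -- The two products differ only in `conj (z b)` against `conj (z a)`, and `conj (z b) = conj (z a)
  -- * (z a * conj (z b))` on the unit circle; this is the source of the factor `z a * conj (z b) -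
  -- 1`.
  have hxi : (conj (multi z I₁) - conj (multi z I₀)) * ((weight z μ I₁ / weight z μ I₀ : ℝ) : ℂ)
      = conj (multi z (Finset.Iic a)) * xi z μ a b := by
    rw [hw, ← Finset.Iio_insert, hI₁, hI₀, multi, multi, Finset.prod_insert haJ,
      Finset.prod_insert hbJ, map_mul, map_mul, xi, Complex.ofReal_mul]
    linear_combination (-(conj (∏ i ∈ Finset.Iio a, z i) * conj (z b) * ((μ b / μ a : ℝ) : ℂ) *
      ((∏ l ∈ Finset.Iio a, ‖(z b - z l) / (z a - z l)‖ ^ 2 : ℝ) : ℂ))) * hzc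
  refine (hO.const_mul_left ((-1) ^ a.val)).congr_left fun t => ?_
  rw [hxi, hI₀, Finset.Iio_insert]
  ring

end asymptotics

/-- The spectral data of a trajectory, and its Verblunsky coefficients as averages with
exponential weights. -/
theorem trajectory_summary {n : ℕ} [NeZero n] {f : Polynomial ℂ}
    {C : ℝ → Matrix (Fin n) (Fin n) ℂ} (hC : IsTrajectory (hamiltonian f) C)
    {α₀ : Fin n → ℂ} (hα₀ : IsVerblunsky α₀) (hC0 : C 0 = cmv α₀)
    {z : Fin n → ℂ} (hz : (C 0).charpoly = ∏ j, (Polynomial.X - Polynomial.C (z j)))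
    {μ : Fin n → ℝ} (hμ : ∀ j, μ j = spectralMass (C 0) (z j)) :
    Function.Injective z ∧ (∀ j, ‖z j‖ = 1) ∧ (∀ j, 0 < μ j) ∧
      ∀ t : ℝ, 0 ≤ t → (∃ α : Fin n → ℂ, IsVerblunsky α ∧ C t = cmv α) ∧
        ∀ α : Fin n → ℂ, IsVerblunsky α → C t = cmv α → ∀ a : Fin n,
          α a = (-1) ^ a.val * expAverage (multiIndices a) (weight z μ)
            (fun I => ∑ i ∈ I, rate f (z i)) (fun I => conj (multi z I)) t := by
  have hn : n ≠ 0 := NeZero.ne n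
  have hU : (C 0)ᴴ * C 0 = 1 := by
    obtain ⟨m, rfl⟩ := Nat.exists_eq_succ_of_ne_zero hn
    rw [hC0]
    exact conjTranspose_mul_cmv hα₀
  obtain ⟨Q, hQ, hCQ⟩ := exists_unitary_diagonalization hU hz
  have h0 : IsShape 0 (C 0) := hC0 ▸ cmv_isShape hα₀
  have h1 : IsShape 1 (C 0)ᴴ := hC0 ▸ cmv_conjTranspose_isShape hα₀
  obtain ⟨hQ0, hinj⟩ := eigenvector_entry_ne_zero h0 h1 hU hQ hCQ
  have hμQ : μ = fun j => ‖Q 0 j‖ ^ 2 := by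
    ext j
    rw [hμ, spectralMass_eq hQ hCQ hinj]
  have hzz := conj_mul_self_eigenvalue hU hQ hCQ
  refine ⟨hinj, fun j => ?_, fun j => ?_, fun t ht => ?_⟩
  · have h := congrArg norm (hzz j)
    rw [norm_mul, RCLike.norm_conj, norm_one] at h
    nlinarith [norm_nonneg (z j)]
  · rw [hμQ]
    exact pow_pos (norm_pos_iff.2 (hQ0 j)) 2
  · obtain ⟨W, hW, hWd, hBW, hX⟩ := exists_lower_intertwining hC hQ hCQ ht
    refine ⟨?_, fun α hα hB a => ?_⟩
    · refine exists_cmv_of_intertwining hα₀ hn hW hWd (hC0 ▸ hBW) hX ?_ hzz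
      have hE : Matrix.diagonal z * expDiag (eulerPoly f) z t
          = expDiag (eulerPoly f) z t * Matrix.diagonal z := by
        simp only [expDiag, Matrix.diagonal_mul_diagonal, mul_comm]
      rw [← mul_assoc, ← mul_assoc, hBW, mul_assoc W, hCQ, mul_assoc (W * Q), ← hE]
      simp only [mul_assoc]
    · rw [hμQ]
      exact coefficient_eq h0 h1 hU hQ hCQ hW hBW hX hα hB a

end CMVFlow

end

theorem theoremT (n : ℕ) [NeZero n] (f : Polynomial ℂ)
    -- a trajectory of the flow of `Im tr f` that starts at a CMV matrix
    (C : ℝ → Matrix (Fin n) (Fin n) ℂ) (hC : IsTrajectory (hamiltonian f) C)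
    (hC0 : ∃ α₀ : Fin n → ℂ, IsVerblunsky α₀ ∧ C 0 = cmv α₀)
    -- the eigenvalues of the initial matrix, listed in an order for which `λ` is non-increasing
    (z : Fin n → ℂ) (hz : (C 0).charpoly = ∏ j, (Polynomial.X - Polynomial.C (z j)))
    (lam : Fin n → ℝ) (hlam : ∀ j, lam j = rate f (z j)) (hanti : Antitone lam)
    -- the masses of the initial spectral measure
    (μ : Fin n → ℝ) (hμ : ∀ j, μ j = spectralMass (C 0) (z j)) :
    -- `C t` stays a CMV matrix
    (∀ t : ℝ, 0 ≤ t → ∃ α : Fin n → ℂ, IsVerblunsky α ∧ C t = cmv α) ∧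
    -- the asymptotics of its Verblunsky coefficients
    ∀ α : ℝ → Fin n → ℂ, (∀ t : ℝ, 0 ≤ t → IsVerblunsky (α t) ∧ C t = cmv (α t)) →
      -- `a` and `b` are the positions of `k` and `k + 1` when counting from `0`
      ∀ a b : Fin n, b.val = a.val + 1 →
        Tendsto (fun t => α t a) atTop (𝓝 (limitValue lam z μ a)) ∧
        (Tendsto (fun t => ‖α t a‖) atTop (𝓝 1) ↔ lam b < lam a) ∧
        (Function.Injective lam →
          0 < lam a - lam b ∧
          ∃ γ : ℝ, lam a - lam b < γ ∧
            (fun t : ℝ => α t a - (-1) ^ a.val * conj (multi z (Finset.Iic a)) *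
              (1 + xi z μ a b * (Real.exp (-(lam a - lam b) * t) : ℂ)))
            =O[atTop] fun t : ℝ => Real.exp (-γ * t)) := by
  obtain ⟨α₀, hα₀, hC0⟩ := hC0
  obtain ⟨hinj, hz1, hμ0, hflow⟩ := trajectory_summary hC hα₀ hC0 hz hμ
  refine ⟨fun t ht => (hflow t ht).1, fun α hα a b hab => ?_⟩
  obtain rfl : lam = fun j => rate f (z j) := funext hlam
  -- The formula holds for `t ≥ 0` only, which is enough for statements at infinity.
  have hev : (fun t => (-1) ^ a.val * expAverage (multiIndices a) (weight z μ)
      (fun I => ∑ i ∈ I, rate f (z i)) (fun I => conj (multi z I)) t) =ᶠ[atTop] fun t => α t a :=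
    (eventually_ge_atTop 0).mono fun t ht => ((hflow t ht).2 _ (hα t ht).1 (hα t ht).2 a).symm
  have hlim := (tendsto_limitValue (a := a) hinj hμ0 hanti).congr' hev
  refine ⟨hlim, ?_, fun hlaminj => ?_⟩
  · rw [← norm_limitValue_eq_one_iff hinj hz1 hμ0 hanti hab]
    exact ⟨fun h => tendsto_nhds_unique hlim.norm h, fun h => h ▸ hlim.norm⟩
  · obtain ⟨hpos, γ, hγ, hO⟩ := expansion_of_injective hinj hz1 hμ0 hanti hlaminj hab
    exact ⟨hpos, γ, hγ, hO.congr' (hev.sub EventuallyEq.rfl) EventuallyEq.rfl⟩
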